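/- Let $G$ be an abelian group with a complete translation invariant metric, and let $|g|$ be the distance from $g$ to $0$. Let $\mathbf P_j(G)$ be the group of polyhedral $j$-chains in $\mathbb R^3$ with coefficients in $G$, that is, of finite sums $\sum g_i\sigma_i$ of bounded oriented $j$-cells $\sigma_i$, two sums being identified when they have the same multiplicity $\mathcal H^j$-almost everywhere on each oriented $j$-plane (for $G=\mathbb Z$: when all smooth differential $j$-forms have the same integral over them). Put $\mathbf P_{-1}(G)=0$, let $\partial$ be the usual boundary operator, zero on $0$-chains, and let $M(P)=\sum|g_i|\,\mathcal H^j(\sigma_i)$ if $P=\sum g_i\sigma_i$ with nonoverlapping $\sigma_i$. Here $\mathcal H^j$ is the $j$-dimensional Hausdorff measure. For $k\ge 0$ let $S_k(G)=\{\delta P: P\in\mathbf P_k(G)\}$ be the group of dipole $k$-chains and $T_k(G)=\{\mu Q: Q\in\mathbf P_{k-1}(G)\}$ the group of mass $k$-chains; $\delta$ and $\mu$ are injective homomorphisms. The group of $k$-dimensional dipolyhedra is $D_k(G)=S_k(G)\oplus T_k(G)$, with the boundary operator $\partial:D_{k+1}(G)\to D_k(G)$ given by $$\partial\,\delta P=\delta\,\partial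 P,\qquad \partial\,\mu Q=\delta Q-\mu\,\partial Q .$$ For $D=\delta P+\mu Q\in D_k(G)$ define the weight $W(D)=M(P)$, the mass $M(D)=M(Q)$, the energy $E(D)=W(D)+M(D)$, and $$E_\flat(D)=\inf\{E(B)+E(C): D=B+\partial C,\ B\in D_k(G),\ C\in D_{k+1}(G)\}.$$ Let $\mathbf D_k(G)$, the group of flat dipolyhedra, be the completion of $D_k(G)$ with respect to $E_\flat$. For $A\in\mathbf D_k(G)$ and $F\in\{W,M,E\}$ define $$F(A)=\inf\{\liminf_{i\to\infty}F(D_i): D_i\in D_k(G),\ D_i\to A \text{ in } E_\flat\}\in[0,\infty].$$ Theorem (lower semicontinuity of weight, mass and energy). Let $k\ge 0$. (1) If $D, D_1, D_2,\dots\in D_k(G)$ and $E_\flat(D_i-D)\to 0$, then $$W(D)\le\liminf_{i\to\infty}W(D_i),\quad M(D)\le\liminf_{i\to\infty}M(D_i),\quad E(D)\le\liminf_{i\to\infty}E(D_i).$$ (2) On $D_k(G)$ the weight, mass and energy of flat dipolyhedra agree with those of dipolyhedra, and $W$, $M$, $E:\mathbf D_k(G)\to[0,\infty]$ are lower semicontinuous.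 -/

import Mathlib

open MeasureTheory Filter Topology
open scoped ENNReal

noncomputable section

namespace SoapFilm

/-- The ambient space `ℝ³` of soap films, with its Euclidean structure. -/
abbrev Space : Type := EuclideanSpace ℝ (Fin 3)

/-! ### Oriented simplices

An oriented (possibly degenerate) simplex is the tuple `σ : Fin n → Space` of its `n` vertices; its
dimension is `n - 1`. Every bounded polyhedral cell is, up to sets of measure zero, a finite disjoint
union of open simplices, so that simplices generate the same polyhedral chains as cells do. For
`n = 0` the tuple is empty and carries the zero chain: there are no cells of dimension `-1`. -/

/-- The open cell spanned by the vertices `σ`: the points with positive barycentric coordinates. -/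
def openSimplex {n : ℕ} (σ : Fin n → Space) : Set Space :=
  {x | ∃ w : Fin n → ℝ, (∀ i, 0 < w i) ∧ ∑ i, w i = 1 ∧ ∑ i, w i • σ i = x}

open Classical in
/-- Comparison of the orientations of two simplices. It is `0` if they do not span the same plane or
if they are degenerate. If both are nondegenerate and span the same plane, it is `1` when they are
equally oriented and `-1` when they are oppositely oriented: then `(σ i, 1) = ∑ j, A i j • (ρ j, 1)`
for an invertible matrix `A` whose determinant has the sign that we want, and the matrix below is the
product of `A` with the Gram matrix of the vectors `(ρ j, 1)`. -/
def orientSign {n : ℕ} (σ ρ : Fin n → Space) : ℤ :=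
  if affineSpan ℝ (Set.range σ) = affineSpan ℝ (Set.range ρ) then
    ((SignType.sign (Matrix.of fun i j => 1 + inner ℝ (σ i) (ρ j)).det : SignType) : ℤ)
  else 0

theorem abs_orientSign_le {n : ℕ} (σ ρ : Fin n → Space) : |orientSign σ ρ| ≤ 1 := by
  unfold orientSign
  split_ifs
  · rcases SignType.sign (Matrix.of fun i j => 1 + inner ℝ (σ i) (ρ j)).det with _ | _ | _ <;>
      decide
  · simp

theorem orientSign_self {n : ℕ} {σ : Fin n → Space} (h : AffineIndependent ℝ σ) :
    orientSign σ σ = 1 := by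
  have hpd : (Matrix.of fun i j => 1 + inner ℝ (σ i) (σ j)).PosDef := by
    refine Matrix.PosDef.of_dotProduct_mulVec_pos ?_ ?_
    · ext i j
      simp [real_inner_comm]
    · intro x hx
      have key : star x ⬝ᵥ ((Matrix.of fun i j => 1 + inner ℝ (σ i) (σ j)).mulVec x)
          = (∑ i, x i) ^ 2 + inner ℝ (∑ i, x i • σ i) (∑ i, x i • σ i) := by
        have e1 : (∑ i, x i) ^ 2 = ∑ i, ∑ j, x i * x j := by
          rw [sq, Finset.sum_mul_sum]
        have e2 : (inner ℝ (∑ i, x i • σ i) (∑ i, x i • σ i) : ℝ) =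
            ∑ i, ∑ j, x i * (x j * inner ℝ (σ i) (σ j)) := by
          rw [sum_inner]
          refine Finset.sum_congr rfl fun i _ => ?_
          rw [inner_sum]
          refine Finset.sum_congr rfl fun j _ => ?_
          rw [real_inner_smul_left, real_inner_smul_right]
        rw [e1, e2, ← Finset.sum_add_distrib]
        simp only [dotProduct, Matrix.mulVec, Matrix.of_apply, Pi.star_apply, star_trivial,
          Finset.mul_sum]
        refine Finset.sum_congr rfl fun i _ => ?_
        rw [← Finset.sum_add_distrib]
        refine Finset.sum_congr rfl fun j _ => ?_
        ring
      rw [key]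
      by_contra hcon
      have h1 : 0 ≤ (∑ i, x i) ^ 2 := sq_nonneg _
      have h2 : (0 : ℝ) ≤ inner ℝ (∑ i, x i • σ i) (∑ i, x i • σ i) := real_inner_self_nonneg
      have h3 : ∑ i, x i = 0 := by
        have : (∑ i, x i) ^ 2 = 0 := by linarith
        simpa using this
      have h4 : ∑ i, x i • σ i = 0 := by
        have : (inner ℝ (∑ i, x i • σ i) (∑ i, x i • σ i) : ℝ) = 0 := by linarith
        exact inner_self_eq_zero.mp this
      apply hx
      funext i
      have := (affineIndependent_iff (k := ℝ) (p := σ)).mp h Finset.univ x h3 h4 i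
        (Finset.mem_univ i)
      simpa using this
  have : SignType.sign (Matrix.of fun i j => 1 + inner ℝ (σ i) (σ j)).det = 1 :=
    sign_eq_one_iff.mpr hpd.det_pos
  rw [orientSign, if_pos rfl, this]
  rfl

theorem measurableSet_openSimplex {n : ℕ} (σ : Fin n → Space) :
    MeasurableSet (openSimplex σ) := by
  have hc : Continuous fun w : Fin n → ℝ => ∑ i, w i • σ i := by fun_prop
  have h : openSimplex σ = ⋃ m : ℕ, (fun w : Fin n → ℝ => ∑ i, w i • σ i) ''
      (Set.Icc (fun _ => 1 / ((m : ℝ) + 1)) (fun _ => 1) ∩ {w | ∑ i, w i = 1}) := by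
    ext x
    simp only [openSimplex, Set.mem_ofPred_eq, Set.mem_iUnion, Set.mem_image, Set.mem_inter_iff,
      Set.mem_Icc]
    constructor
    · rintro ⟨w, hw, hs, hx⟩
      have : ∃ m : ℕ, ∀ i, 1 / ((m : ℝ) + 1) ≤ w i := by
        choose f hf using fun i => exists_nat_one_div_lt (hw i)
        refine ⟨∑ i, f i, fun i => le_trans ?_ (hf i).le⟩
        have : f i ≤ ∑ i, f i := Finset.single_le_sum (fun _ _ => Nat.zero_le _) (Finset.mem_univ i)
        have : (f i : ℝ) ≤ ((∑ i, f i : ℕ) : ℝ) := by exact_mod_cast this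
        gcongr
      obtain ⟨m, hm⟩ := this
      refine ⟨m, w, ⟨⟨hm, fun i => ?_⟩, hs⟩, hx⟩
      rw [← hs]
      exact Finset.single_le_sum (fun j _ => (hw j).le) (Finset.mem_univ i)
    · rintro ⟨m, w, ⟨⟨h1, -⟩, hs⟩, hx⟩
      exact ⟨w, fun i => lt_of_lt_of_le (by positivity) (h1 i), hs, hx⟩
  rw [h]
  refine MeasurableSet.iUnion fun m => IsCompact.measurableSet (IsCompact.image ?_ hc)
  exact isCompact_Icc.inter_right (isClosed_eq (by fun_prop) continuous_const)

theorem measure_openSimplex_lt_top {n : ℕ} (σ : Fin n → Space) :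
    (μHE[n - 1] : Measure Space) (openSimplex σ) < ∞ := by
  rcases n with _ | m
  · have : openSimplex σ = ∅ := by
      ext x
      simp [openSimplex]
    simp [this]
  · let L : (Fin m → ℝ) →ₗ[ℝ] Space :=
      { toFun := fun w => ∑ i, w i • (σ i.succ - σ 0)
        map_add' := fun a b => by simp [add_smul, Finset.sum_add_distrib]
        map_smul' := fun a b => by simp [mul_smul, Finset.smul_sum] }
    let Lc : (Fin m → ℝ) →L[ℝ] Space := LinearMap.toContinuousLinearMap L
    have hL : LipschitzWith ‖Lc‖₊ fun w : Fin m → ℝ => σ 0 + L w := by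
      have h1 : LipschitzWith ‖Lc‖₊ fun w : Fin m → ℝ => L w := Lc.lipschitz
      intro a b
      simpa using h1 a b
    have hsub : openSimplex σ ⊆ (fun w : Fin m → ℝ => σ 0 + L w) '' Set.Icc 0 1 := by
      rintro x ⟨w, hw, hs, rfl⟩
      refine ⟨fun i => w i.succ, ⟨fun i => (hw _).le, fun i => ?_⟩, ?_⟩
      · change w i.succ ≤ 1
        rw [← hs]
        exact Finset.single_le_sum (fun j _ => (hw j).le) (Finset.mem_univ i.succ)
      · rw [Fin.sum_univ_succ] at hs
        have h0 : w 0 = 1 - ∑ i : Fin m, w i.succ := by linarith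
        simp only [L, LinearMap.coe_mk, AddHom.coe_mk]
        rw [Fin.sum_univ_succ, h0]
        simp only [smul_sub, Finset.sum_sub_distrib, sub_smul, one_smul, Finset.sum_smul]
        abel
    have hfin : (μH[(m : ℝ)] : Measure Space) (openSimplex σ) < ∞ := by
      refine lt_of_le_of_lt (measure_mono hsub) ?_
      refine lt_of_le_of_lt (hL.hausdorffMeasure_image_le (Nat.cast_nonneg m) _) ?_
      have hv : (μH[(m : ℝ)] : Measure (Fin m → ℝ)) = volume := by
        simpa using hausdorffMeasure_pi_real (ι := Fin m)
      rw [hv]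
      refine ENNReal.mul_lt_top (by simp) ?_
      exact isCompact_Icc.measure_lt_top
    rw [Nat.add_sub_cancel, Measure.euclideanHausdorffMeasure_def, Measure.smul_apply,
      ENNReal.smul_def, smul_eq_mul]
    exact ENNReal.mul_lt_top (by simp) hfin

/-! ### Formal chains, their multiplicity and their boundary -/

/-- Finite formal sums of oriented simplices with `n` vertices and with coefficients in `G`. -/
abbrev SimplexChain (G : Type*) [AddCommGroup G] (n : ℕ) : Type _ := (Fin n → Space) →₀ G

/-- The multiplicity with which the formal chain `c` covers the point `x`, with respect to the plane
through `x` that is spanned and oriented by the simplex `ρ`. -/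
def multiplicity {G : Type*} [AddCommGroup G] {n : ℕ} (ρ : Fin n → Space) (x : Space) :
    SimplexChain G n →+ G :=
  open Classical in
  Finsupp.liftAddHom fun σ =>
    if x ∈ openSimplex σ then orientSign σ ρ • AddMonoidHom.id G else 0

/-- The usual boundary of a formal chain, `∂[v₀, …, vₙ] = ∑ (-1)^i [v₀, …, v̂ᵢ, …, vₙ]`. -/
def simplexBoundary (G : Type*) [AddCommGroup G] (n : ℕ) :
    SimplexChain G (n + 1) →+ SimplexChain G n :=
  Finsupp.liftAddHom fun σ =>
    ∑ i : Fin (n + 1), (-1 : ℤ) ^ (i : ℕ) • Finsupp.singleAddHom (fun j => σ (i.succAbove j))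

theorem simplexBoundary_single {G : Type*} [AddCommGroup G] (n : ℕ) (σ : Fin (n + 1) → Space)
    (g : G) : simplexBoundary G n (Finsupp.single σ g) =
      ∑ i : Fin (n + 1), (-1 : ℤ) ^ (i : ℕ) • Finsupp.single (fun j => σ (i.succAbove j)) g := by
  simp [simplexBoundary, AddMonoidHom.finsetSum_apply]

theorem simplexBoundary_simplexBoundary {G : Type*} [AddCommGroup G] (n : ℕ)
    (c : SimplexChain G (n + 2)) : simplexBoundary G n (simplexBoundary G (n + 1) c) = 0 := by
  induction c using Finsupp.induction_linear with
  | zero => rw [map_zero, map_zero]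
  | add a b ha hb => rw [map_add, map_add, ha, hb, add_zero]
  | single σ g =>
    simp only [simplexBoundary_single, map_sum, map_zsmul, Finset.smul_sum, smul_smul, ← pow_add]
    rw [← Fintype.sum_prod_type' (f := fun (i : Fin (n + 2)) (j : Fin (n + 1)) =>
      (-1 : ℤ) ^ ((i : ℕ) + (j : ℕ)) •
        Finsupp.single (fun l => σ (i.succAbove (j.succAbove l))) g)]
    refine Finset.sum_involution
      (fun p _ => (p.1.succAbove p.2, p.2.predAbove p.1)) ?_ ?_ ?_ ?_
    · rintro ⟨i, j⟩ -
      simp only [Fin.succAbove_succAbove_succAbove_predAbove,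
        Fin.neg_one_pow_succAbove_add_predAbove, neg_smul, add_neg_cancel]
    · rintro ⟨i, j⟩ - - h
      exact Fin.succAbove_ne i j (congrArg Prod.fst h)
    · intros
      exact Finset.mem_univ _
    · rintro ⟨i, j⟩ -
      simp only [Fin.succAbove_succAbove_predAbove, Fin.predAbove_predAbove_succAbove]

variable (G : Type*) [NormedAddCommGroup G]

/-- The formal chains of `n`-vertex simplices that cover `𝓗ⁿ⁻¹`-almost every point with multiplicity
zero. Over `ℤ` these are the chains over which all smooth differential forms integrate to zero. -/
def multiplicityNull (n : ℕ) : AddSubgroup (SimplexChain G n) where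
  carrier := {c | ∀ᵐ x ∂(μHE[n - 1] : Measure Space), ∀ ρ, multiplicity ρ x c = 0}
  zero_mem' := by simp
  add_mem' {a b} ha hb := by
    simp only [Set.mem_ofPred_eq] at ha hb ⊢
    filter_upwards [ha, hb] with x h1 h2 ρ
    rw [map_add, h1, h2, add_zero]
  neg_mem' {a} ha := by
    simp only [Set.mem_ofPred_eq] at ha ⊢
    filter_upwards [ha] with x h1 ρ
    rw [map_neg, h1, neg_zero]

/-- The formal chains that represent the zero polyhedral chain: multiplicity zero almost everywhere.
By the theorem of Stokes the boundary of such a chain has the same property; it is listed as well so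
that the boundary is visibly well defined on equivalence classes. -/
def nullChains : (n : ℕ) → AddSubgroup (SimplexChain G n)
  | 0 => multiplicityNull G 0
  | n + 1 => multiplicityNull G (n + 1) ⊓ (multiplicityNull G n).comap (simplexBoundary G n)

theorem nullChains_le (n : ℕ) : nullChains G n ≤ multiplicityNull G n := by
  rcases n with _ | n
  · exact le_rfl
  · exact inf_le_left

theorem simplexBoundary_mem (n : ℕ) :
    nullChains G (n + 1) ≤ (nullChains G n).comap (simplexBoundary G n) := by
  intro c hc
  rcases n with _ | n
  · exact hc.2
  · refine ⟨hc.2, ?_⟩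
    change simplexBoundary G n (simplexBoundary G (n + 1) c) ∈ multiplicityNull G n
    rw [simplexBoundary_simplexBoundary]
    exact zero_mem _

/-! ### Polyhedral chains -/

/-- Polyhedral chains in `ℝ³` of dimension `n - 1` (generated by simplices with `n` vertices), with
coefficients in `G`. The group is trivial for `n = 0`. -/
abbrev PolyChain (n : ℕ) : Type _ := SimplexChain G n ⧸ nullChains G n

/-- The boundary operator on polyhedral chains. It vanishes on `0`-chains, since `PolyChain G 0`
is trivial. -/
def polyBoundary (n : ℕ) : PolyChain G (n + 1) →+ PolyChain G n :=
  QuotientAddGroup.map _ _ (simplexBoundary G n) (simplexBoundary_mem G n)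

variable {G}

theorem multiplicity_zero_vertices (ρ : Fin 0 → Space) (x : Space) (c : SimplexChain G 0) :
    multiplicity ρ x c = 0 := by
  have h : ∀ σ : Fin 0 → Space, x ∉ openSimplex σ := fun σ => by simp [openSimplex]
  rw [multiplicity, Finsupp.liftAddHom_apply]
  exact Finset.sum_eq_zero fun σ _ => by simp [h]

instance : Subsingleton (PolyChain G 0) := by
  rw [QuotientAddGroup.subsingleton_iff, eq_top_iff]
  intro c _
  have h : ∀ᵐ x ∂(μHE[0 - 1] : Measure Space), ∀ ρ, multiplicity ρ x c = 0 :=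
    Eventually.of_forall fun x ρ => multiplicity_zero_vertices ρ x c
  exact h

/-- The modulus of the multiplicity of a formal chain at `x`. At almost every `x` only one plane
carries a nonzero multiplicity, and its modulus does not depend on the orientation. -/
def absMultiplicity {n : ℕ} (c : SimplexChain G n) (x : Space) : ℝ≥0∞ :=
  ⨆ ρ : Fin n → Space, ‖multiplicity ρ x c‖ₑ

theorem multiplicity_eq_sum {n : ℕ} (ρ : Fin n → Space) (x : Space) (c : SimplexChain G n) :
    multiplicity ρ x c = open Classical in
      ∑ σ ∈ c.support, if x ∈ openSimplex σ then orientSign σ ρ • c σ else 0 := by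
  classical
  rw [multiplicity, Finsupp.liftAddHom_apply, Finsupp.sum]
  refine Finset.sum_congr rfl fun σ _ => ?_
  split_ifs <;> simp

theorem absMultiplicity_add_le {n : ℕ} (c d : SimplexChain G n) (x : Space) :
    absMultiplicity (c + d) x ≤ absMultiplicity c x + absMultiplicity d x := by
  refine iSup_le fun ρ => ?_
  rw [map_add]
  exact (enorm_add_le _ _).trans (add_le_add
    (le_iSup (fun ρ => ‖multiplicity ρ x c‖ₑ) ρ) (le_iSup (fun ρ => ‖multiplicity ρ x d‖ₑ) ρ))

theorem absMultiplicity_neg {n : ℕ} (c : SimplexChain G n) (x : Space) :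
    absMultiplicity (-c) x = absMultiplicity c x := by
  simp [absMultiplicity]

theorem enorm_sign_smul_le {n : ℕ} (σ ρ : Fin n → Space) (g : G) :
    ‖orientSign σ ρ • g‖ₑ ≤ ‖g‖ₑ := by
  have h := abs_le.mp (abs_orientSign_le σ ρ)
  have : orientSign σ ρ = -1 ∨ orientSign σ ρ = 0 ∨ orientSign σ ρ = 1 := by omega
  rcases this with h | h | h <;> simp [h]

theorem absMultiplicity_le {n : ℕ} (c : SimplexChain G n) (x : Space) :
    absMultiplicity c x ≤ ∑ σ ∈ c.support, (openSimplex σ).indicator (fun _ => ‖c σ‖ₑ) x := by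
  classical
  refine iSup_le fun ρ => ?_
  rw [multiplicity_eq_sum]
  refine (enorm_sum_le _ _).trans (Finset.sum_le_sum fun σ _ => ?_)
  by_cases hx : x ∈ openSimplex σ
  · simpa [hx] using enorm_sign_smul_le σ ρ (c σ)
  · simp [hx]

theorem measurable_absMultiplicity {n : ℕ} (c : SimplexChain G n) :
    Measurable (absMultiplicity c) := by
  classical
  let F : (c.support → Prop) → ℝ≥0∞ := fun p => ⨆ ρ : Fin n → Space,
    ‖∑ σ : c.support, if p σ then orientSign (σ : Fin n → Space) ρ • c σ else 0‖ₑ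
  have h : absMultiplicity c = F ∘ fun x (σ : c.support) => x ∈ openSimplex (σ : Fin n → Space) := by
    funext x
    simp only [absMultiplicity, F, Function.comp]
    congr 1
    funext ρ
    rw [multiplicity_eq_sum, ← Finset.sum_coe_sort]
  rw [h]
  refine (measurable_of_finite F).comp (measurable_pi_lambda _ fun σ => ?_)
  exact measurable_mem.mpr (measurableSet_openSimplex _)

/-- The integral of the modulus of the multiplicity of a formal chain. -/
def simplexMass {n : ℕ} (c : SimplexChain G n) : ℝ≥0∞ :=
  ∫⁻ x, absMultiplicity c x ∂(μHE[n - 1] : Measure Space)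

/-- The mass of a polyhedral chain of dimension `n - 1`: its `(n - 1)`-dimensional Hausdorff measure,
counted with the modulus of the multiplicity. It is `∑ |gᵢ| M(σᵢ)` for a nonoverlapping
representation, see `polyMass_eq_sum`. -/
def polyMass {n : ℕ} (P : PolyChain G n) : ℝ≥0∞ :=
  Quotient.liftOn' P simplexMass (by
    intro a b hab
    have h := nullChains_le G n (QuotientAddGroup.leftRel_apply.mp hab)
    refine lintegral_congr_ae ?_
    filter_upwards [show ∀ᵐ x ∂(μHE[n - 1] : Measure Space),
      ∀ ρ, multiplicity ρ x (-a + b) = 0 from h] with x hx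
    refine iSup_congr fun ρ => ?_
    have := hx ρ
    rw [map_add, map_neg, neg_add_eq_zero] at this
    rw [this])

theorem polyMass_mk {n : ℕ} (c : SimplexChain G n) :
    polyMass (c : PolyChain G n) = simplexMass c := rfl

theorem polyMass_zero {n : ℕ} : polyMass (0 : PolyChain G n) = 0 := by
  change simplexMass (0 : SimplexChain G n) = 0
  simp [simplexMass, absMultiplicity]

theorem polyMass_neg {n : ℕ} (P : PolyChain G n) : polyMass (-P) = polyMass P := by
  induction P using QuotientAddGroup.induction_on with
  | H c =>
    rw [← QuotientAddGroup.mk_neg, polyMass_mk, polyMass_mk]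
    simp only [simplexMass, absMultiplicity_neg]

theorem polyMass_add_le {n : ℕ} (P Q : PolyChain G n) :
    polyMass (P + Q) ≤ polyMass P + polyMass Q := by
  induction P using QuotientAddGroup.induction_on with
  | H c =>
    induction Q using QuotientAddGroup.induction_on with
    | H d =>
      rw [← QuotientAddGroup.mk_add, polyMass_mk, polyMass_mk, polyMass_mk, simplexMass,
        simplexMass, simplexMass, ← lintegral_add_left (measurable_absMultiplicity c)]
      exact lintegral_mono fun x => absMultiplicity_add_le c d x

theorem polyMass_lt_top {n : ℕ} (P : PolyChain G n) : polyMass P < ∞ := by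
  induction P using QuotientAddGroup.induction_on with
  | H c =>
    rw [polyMass_mk]
    refine lt_of_le_of_lt (lintegral_mono fun x => absMultiplicity_le c x) ?_
    rw [lintegral_finsetSum _ fun σ _ => measurable_const.indicator (measurableSet_openSimplex σ)]
    refine ENNReal.sum_lt_top.mpr fun σ _ => ?_
    rw [lintegral_indicator_const (measurableSet_openSimplex σ)]
    exact ENNReal.mul_lt_top enorm_lt_top (measure_openSimplex_lt_top σ)

/-- The mass of a nonoverlapping sum `∑ gᵢ σᵢ` of nondegenerate cells is `∑ |gᵢ| M(σᵢ)`, where `M(σᵢ)`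
is the Hausdorff measure of `σᵢ`. -/
theorem polyMass_eq_sum {n : ℕ} (c : SimplexChain G n)
    (hc : ∀ σ ∈ c.support, AffineIndependent ℝ σ)
    (hd : (c.support : Set (Fin n → Space)).Pairwise
      fun σ τ => AEDisjoint (μHE[n - 1] : Measure Space) (openSimplex σ) (openSimplex τ)) :
    polyMass (c : PolyChain G n) =
      ∑ σ ∈ c.support, ‖c σ‖ₑ * (μHE[n - 1] : Measure Space) (openSimplex σ) := by
  classical
  have hae : ∀ᵐ x ∂(μHE[n - 1] : Measure Space), ∀ σ ∈ c.support, ∀ τ ∈ c.support, σ ≠ τ →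
      ¬ (x ∈ openSimplex σ ∧ x ∈ openSimplex τ) := by
    rw [Finset.eventually_all]
    intro σ hσ
    rw [Finset.eventually_all]
    intro τ hτ
    by_cases h : σ = τ
    · simp [h]
    · filter_upwards [measure_eq_zero_iff_ae_notMem.mp (hd hσ hτ h)] with x hx _
      exact hx
  have hmain : polyMass (c : PolyChain G n) = ∫⁻ x, ∑ σ ∈ c.support,
      (openSimplex σ).indicator (fun _ => ‖c σ‖ₑ) x ∂(μHE[n - 1] : Measure Space) := by
    rw [polyMass_mk]
    refine lintegral_congr_ae ?_
    filter_upwards [hae] with x hx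
    refine le_antisymm (absMultiplicity_le c x) ?_
    by_cases h : ∃ σ ∈ c.support, x ∈ openSimplex σ
    · obtain ⟨σ, hσ, hxσ⟩ := h
      have hne : ∀ τ ∈ c.support, τ ≠ σ → x ∉ openSimplex τ := fun τ hτ hne hxτ =>
        hx τ hτ σ hσ hne ⟨hxτ, hxσ⟩
      rw [Finset.sum_eq_single_of_mem σ hσ fun τ hτ hτσ => by simp [hne τ hτ hτσ]]
      refine le_trans (le_of_eq ?_) (le_iSup (fun ρ => ‖multiplicity ρ x c‖ₑ) σ)
      rw [multiplicity_eq_sum, Finset.sum_eq_single_of_mem σ hσ fun τ hτ hτσ => by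
        simp [hne τ hτ hτσ]]
      simp [hxσ, orientSign_self (hc σ hσ)]
    · push Not at h
      rw [Finset.sum_eq_zero fun σ hσ => by simp [h σ hσ]]
      exact zero_le
  rw [hmain, lintegral_finsetSum _ fun σ _ =>
    measurable_const.indicator (measurableSet_openSimplex σ)]
  exact Finset.sum_congr rfl fun σ _ => lintegral_indicator_const (measurableSet_openSimplex σ) _

/-! ### Dipolyhedra -/

variable (G)

/-- The group `D_k(G) = S_k(G) ⊕ T_k(G)` of `k`-dimensional dipolyhedra `D = S + T`. The dipole chain
`S = δP` is given by a polyhedral `k`-chain `P`, which is the first component, and the mass chain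
`T = μQ` by a polyhedral `(k-1)`-chain `Q`, which is the second component. -/
def Dipolyhedron (k : ℕ) : Type _ := PolyChain G (k + 1) × PolyChain G k

instance (k : ℕ) : AddCommGroup (Dipolyhedron G k) :=
  inferInstanceAs (AddCommGroup (PolyChain G (k + 1) × PolyChain G k))

/-- The dipole chain `δP` of a polyhedral `k`-chain `P`. -/
def dipole (k : ℕ) : PolyChain G (k + 1) →+ Dipolyhedron G k :=
  AddMonoidHom.inl (PolyChain G (k + 1)) (PolyChain G k)

/-- The mass chain `μQ` of a polyhedral `(k-1)`-chain `Q`. -/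
def massChain (k : ℕ) : PolyChain G k →+ Dipolyhedron G k :=
  AddMonoidHom.inr (PolyChain G (k + 1)) (PolyChain G k)

/-- The boundary operator on dipolyhedra. It is determined by `∂δP = δ∂P` and by the magic formula
`δQ = μ∂Q + ∂μQ`, see `boundary_dipole` and `boundary_massChain`. -/
def boundary (k : ℕ) : Dipolyhedron G (k + 1) →+ Dipolyhedron G k :=
  AddMonoidHom.coprod ((dipole G k).comp (polyBoundary G (k + 1)))
    (dipole G k - (massChain G k).comp (polyBoundary G k))

variable {G}

theorem dipole_add_massChain {k : ℕ} (D : Dipolyhedron G k) :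
    D = dipole G k D.1 + massChain G k D.2 := by
  refine Prod.ext ?_ ?_
  · exact (add_zero D.1).symm
  · exact (zero_add D.2).symm

theorem boundary_dipole {k : ℕ} (P : PolyChain G (k + 2)) :
    boundary G k (dipole G (k + 1) P) = dipole G k (polyBoundary G (k + 1) P) := by
  change dipole G k (polyBoundary G (k + 1) P) + (dipole G k - (massChain G k).comp
    (polyBoundary G k)) 0 = _
  rw [map_zero, add_zero]

theorem boundary_massChain {k : ℕ} (Q : PolyChain G (k + 1)) :
    dipole G k Q =
      massChain G k (polyBoundary G k Q) + boundary G k (massChain G (k + 1) Q) := by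
  change _ = _ + ((dipole G k).comp (polyBoundary G (k + 1)) 0 +
    (dipole G k Q - massChain G k (polyBoundary G k Q)))
  rw [map_zero]
  abel

/-- The weight `W(D) = W(S)` of `D = S + T`, where `W(δP) = M(P)`. -/
def weight {k : ℕ} (D : Dipolyhedron G k) : ℝ≥0∞ := polyMass D.1

/-- The mass `M(D) = M(T)` of `D = S + T`, where `M(μQ) = M(Q)`. -/
def mass {k : ℕ} (D : Dipolyhedron G k) : ℝ≥0∞ := polyMass D.2

/-- The energy `E(D) = W(S) + M(T)` of `D = S + T`. -/
def energy {k : ℕ} (D : Dipolyhedron G k) : ℝ≥0∞ := weight D + mass D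

/-- The flat energy norm `E_♭(D) = inf {E(B) + E(C) : D = B + ∂C}`. -/
def flatEnergy {k : ℕ} (D : Dipolyhedron G k) : ℝ≥0∞ :=
  ⨅ (B : Dipolyhedron G k) (C : Dipolyhedron G (k + 1)) (_ : D = B + boundary G k C),
    energy B + energy C

theorem energy_zero {k : ℕ} : energy (0 : Dipolyhedron G k) = 0 := by
  change polyMass (0 : PolyChain G (k + 1)) + polyMass (0 : PolyChain G k) = 0
  rw [polyMass_zero, polyMass_zero, add_zero]

theorem energy_neg {k : ℕ} (D : Dipolyhedron G k) : energy (-D) = energy D := by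
  change polyMass (-D.1) + polyMass (-D.2) = polyMass D.1 + polyMass D.2
  rw [polyMass_neg, polyMass_neg]

theorem energy_add_le {k : ℕ} (D D' : Dipolyhedron G k) :
    energy (D + D') ≤ energy D + energy D' := by
  change polyMass (D.1 + D'.1) + polyMass (D.2 + D'.2) ≤
    polyMass D.1 + polyMass D.2 + (polyMass D'.1 + polyMass D'.2)
  refine (add_le_add (polyMass_add_le _ _) (polyMass_add_le _ _)).trans (le_of_eq ?_)
  ring

theorem flatEnergy_le {k : ℕ} {D B : Dipolyhedron G k} {C : Dipolyhedron G (k + 1)}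
    (h : D = B + boundary G k C) : flatEnergy D ≤ energy B + energy C :=
  iInf_le_of_le B (iInf_le_of_le C (iInf_le_of_le h le_rfl))

theorem flatEnergy_le_energy {k : ℕ} (D : Dipolyhedron G k) : flatEnergy D ≤ energy D := by
  have h := flatEnergy_le (D := D) (B := D) (C := 0) (by rw [map_zero, add_zero])
  rwa [energy_zero, add_zero] at h

theorem flatEnergy_lt_top {k : ℕ} (D : Dipolyhedron G k) : flatEnergy D < ∞ :=
  (flatEnergy_le_energy D).trans_lt
    (ENNReal.add_lt_top.mpr ⟨polyMass_lt_top D.1, polyMass_lt_top D.2⟩)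

theorem flatEnergy_zero {k : ℕ} : flatEnergy (0 : Dipolyhedron G k) = 0 :=
  le_antisymm ((flatEnergy_le_energy 0).trans energy_zero.le) zero_le

theorem flatEnergy_neg_le {k : ℕ} (D : Dipolyhedron G k) : flatEnergy (-D) ≤ flatEnergy D := by
  refine le_iInf fun B => le_iInf fun C => le_iInf fun h => ?_
  rw [← energy_neg B, ← energy_neg C]
  exact flatEnergy_le (by rw [h, map_neg, neg_add])

theorem flatEnergy_add_le {k : ℕ} (D D' : Dipolyhedron G k) :
    flatEnergy (D + D') ≤ flatEnergy D + flatEnergy D' := by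
  refine ENNReal.le_of_forall_pos_le_add fun ε hε _ => ?_
  have hε2 : (0 : ℝ≥0∞) < ε / 2 := ENNReal.half_pos (by exact_mod_cast hε.ne')
  have hex : ∀ A : Dipolyhedron G k, ∃ (B : Dipolyhedron G k) (C : Dipolyhedron G (k + 1)),
      A = B + boundary G k C ∧ energy B + energy C < flatEnergy A + ε / 2 := by
    intro A
    have h := ENNReal.lt_add_right (flatEnergy_lt_top A).ne hε2.ne'
    nth_rewrite 1 [flatEnergy] at h
    simp only [iInf_lt_iff] at h
    obtain ⟨B, C, hA, h⟩ := h
    exact ⟨B, C, hA, h⟩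
  obtain ⟨B, C, hD, h⟩ := hex D
  obtain ⟨B', C', hD', h'⟩ := hex D'
  calc flatEnergy (D + D') ≤ energy (B + B') + energy (C + C') :=
        flatEnergy_le (by rw [hD, hD', map_add]; abel)
    _ ≤ (energy B + energy B') + (energy C + energy C') :=
        add_le_add (energy_add_le _ _) (energy_add_le _ _)
    _ = (energy B + energy C) + (energy B' + energy C') := by ring
    _ ≤ (flatEnergy D + ε / 2) + (flatEnergy D' + ε / 2) := add_le_add h.le h'.le
    _ = flatEnergy D + flatEnergy D' + (ε / 2 + ε / 2) := by ring
    _ = flatEnergy D + flatEnergy D' + ε := by rw [ENNReal.add_halves]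

/-- `E_♭` as a seminorm on the group of dipolyhedra. -/
def flatSeminorm (k : ℕ) : AddGroupSeminorm (Dipolyhedron G k) where
  toFun D := (flatEnergy D).toReal
  map_zero' := by simp [flatEnergy_zero]
  add_le' D D' := by
    rw [← ENNReal.toReal_add (flatEnergy_lt_top D).ne (flatEnergy_lt_top D').ne]
    exact ENNReal.toReal_mono (ENNReal.add_lt_top.mpr
      ⟨flatEnergy_lt_top D, flatEnergy_lt_top D'⟩).ne (flatEnergy_add_le D D')
  neg' D := by
    congr 1
    refine le_antisymm (flatEnergy_neg_le D) ?_
    simpa using flatEnergy_neg_le (-D)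

/-- The group of dipolyhedra, normed by `‖D‖ = E_♭(D)`. -/
instance (k : ℕ) : SeminormedAddCommGroup (Dipolyhedron G k) :=
  AddGroupSeminorm.toSeminormedAddCommGroup (flatSeminorm k)

theorem norm_eq_flatEnergy {k : ℕ} (D : Dipolyhedron G k) : ‖D‖ = (flatEnergy D).toReal := rfl

/-! ### Flat dipolyhedra -/

variable (G)

/-- The group `𝐃_k(G)` of flat dipolyhedra: the completion of `D_k(G)` with respect to `E_♭`. -/
abbrev FlatDipolyhedron (k : ℕ) : Type _ := UniformSpace.Completion (Dipolyhedron G k)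

variable {G}

/-- The extension `F(A) = inf {liminf F(D_i) : D_i → A, D_i ∈ D_k(G)}` of a functional `F` from
dipolyhedra to flat dipolyhedra. -/
def relaxation {k : ℕ} (F : Dipolyhedron G k → ℝ≥0∞) (A : FlatDipolyhedron G k) : ℝ≥0∞ :=
  ⨅ (D : ℕ → Dipolyhedron G k)
    (_ : Tendsto (fun i => (D i : FlatDipolyhedron G k)) atTop (𝓝 A)),
    liminf (fun i => F (D i)) atTop

/-- The weight of a flat dipolyhedron. -/
def flatWeight {k : ℕ} (A : FlatDipolyhedron G k) : ℝ≥0∞ := relaxation weight A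

/-- The mass of a flat dipolyhedron. -/
def flatMass {k : ℕ} (A : FlatDipolyhedron G k) : ℝ≥0∞ := relaxation mass A

/-- The energy of a flat dipolyhedron. -/
def flatDipolyhedronEnergy {k : ℕ} (A : FlatDipolyhedron G k) : ℝ≥0∞ := relaxation energy A

end SoapFilm

end

noncomputable section

namespace SoapFilm

/-! ### Intersections of simplices with the fibres of linear maps -/

/-! If `D' - D = B + ∂C`, the first components differ by `B.1 + C.2 + ∂C.1` and the second ones by
`B.2 - ∂C.2`: in each case a chain of small mass plus the boundary of a chain of small mass. Weight
and mass are therefore lower semicontinuous as soon as the mass of polyhedral chains is so in the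
flat norm. The quantitative form is `exists_le_polyMass_add`: every η < M(P) satisfies η ≤ M(P + B +
∂C) + M(B) + K M(C), with K depending on P and η only.

This is proved by integral geometry. Let `a` be the rows of a linear map to ℝᵐ. The fibre over `x`
meets a generic m-chain in finitely many points, and by the area formula the moduli of the
multiplicities there, integrated over `x` and averaged over `a` in a ball, give a constant multiple
of the mass; rotation invariance makes the constant the same for all planes
(`lintegral_lintegral_sum_fibreTerm`). An intersection number with the fibre may lose mass by
cancellation, so the fibre is cut by thin slabs orthogonal to a vector `h`. The resulting
`averagedVariation` V at scale d, a subadditive function of the chain, has three properties: V(c) is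
at most d times a constant multiple of the mass of c (`averagedVariation_le`); in the limit d → 0
nothing is lost, because a thin slab contains at most one of the intersection points
(`le_liminf_averagedVariation`, by Fatou); V(∂c) is at most a constant times the mass of c,
uniformly in d (`exists_averagedVariation_simplexBoundary_le`). The last one rests on the
fundamental theorem of calculus on a fibre (`sum_crossSign_face`): ∂c meets a half space of the
fibre as often, up to sign, as c meets the bounding hyperplane of that half space, that is, a fibre
of the map with the additional row `h`. A scale chosen for P and η then gives K, of order 1/d.

The energy follows from superadditivity of the lower limit. The relaxation of any functional is
lower semicontinuous by a diagonal choice (`lowerSemicontinuous_relaxation`), and it agrees with a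
functional that is lower semicontinuous on dipolyhedra (`relaxation_coe`). -/

/-- The homogeneous coordinates `(1, ⟨a l, σ j⟩)` of the images of the vertices of `σ` under the
linear map with rows `a`. -/
def homogeneousMatrix {m : ℕ} (a : Fin m → Space) (σ : Fin (m + 1) → Space) :
    Matrix (Fin (m + 1)) (Fin (m + 1)) ℝ :=
  Matrix.of fun i j => (Fin.cons 1 (fun l => inner ℝ (a l) (σ j)) : Fin (m + 1) → ℝ) i

/-- The barycentric coordinates of `x` with respect to the image of `σ`. -/
def crossWeights {m : ℕ} (a : Fin m → Space) (x : Fin m → ℝ) (σ : Fin (m + 1) → Space) :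
    Fin (m + 1) → ℝ :=
  (homogeneousMatrix a σ)⁻¹.mulVec (Fin.cons 1 x)

/-- The point in which the plane of `σ` meets the fibre over `x`. -/
def crossPoint {m : ℕ} (a : Fin m → Space) (x : Fin m → ℝ) (σ : Fin (m + 1) → Space) : Space :=
  ∑ j, crossWeights a x σ j • σ j

open Classical in
/-- The sign of the intersection of the open simplex `σ` with the part in `U` of the fibre
over `x`. -/
def crossSign {m : ℕ} (a : Fin m → Space) (x : Fin m → ℝ) (U : Set Space)
    (σ : Fin (m + 1) → Space) : ℤ :=
  if (∀ j, 0 < crossWeights a x σ j) ∧ crossPoint a x σ ∈ U then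
    ((SignType.sign (homogeneousMatrix a σ).det : SignType) : ℤ) else 0

/-- The intersection number of a chain with the part in `U` of the fibre over `x`. -/
def crossing {G : Type*} [AddCommGroup G] {m : ℕ} (a : Fin m → Space) (x : Fin m → ℝ)
    (U : Set Space) : SimplexChain G (m + 1) →+ G :=
  Finsupp.liftAddHom fun σ => crossSign a x U σ • AddMonoidHom.id G

theorem crossing_eq_sum {G : Type*} [AddCommGroup G] {m : ℕ} (a : Fin m → Space)
    (x : Fin m → ℝ) (U : Set Space) (c : SimplexChain G (m + 1)) :
    crossing a x U c = ∑ σ ∈ c.support, crossSign a x U σ • c σ := by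
  rw [crossing, Finsupp.liftAddHom_apply, Finsupp.sum]
  rfl

theorem crossing_single {G : Type*} [AddCommGroup G] {m : ℕ} (a : Fin m → Space)
    (x : Fin m → ℝ) (U : Set Space) (σ : Fin (m + 1) → Space) (g : G) :
    crossing a x U (Finsupp.single σ g) = crossSign a x U σ • g := by
  simp [crossing]

section

variable {m : ℕ} {a : Fin m → Space} {x : Fin m → ℝ} {σ ρ τ : Fin (m + 1) → Space}

theorem homogeneousMatrix_mulVec (a : Fin m → Space) (σ : Fin (m + 1) → Space)
    (w : Fin (m + 1) → ℝ) : (homogeneousMatrix a σ).mulVec w =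
      (Fin.cons (∑ j, w j) (fun l => inner ℝ (a l) (∑ j, w j • σ j)) : Fin (m + 1) → ℝ) := by
  funext i
  refine Fin.cases ?_ (fun l => ?_) i
  · simp [homogeneousMatrix, Matrix.mulVec, dotProduct]
  · simp [homogeneousMatrix, Matrix.mulVec, dotProduct, inner_sum, real_inner_smul_right, mul_comm]

theorem homogeneousMatrix_mulVec_eq_iff {w : Fin (m + 1) → ℝ} :
    (homogeneousMatrix a σ).mulVec w = (Fin.cons 1 x : Fin (m + 1) → ℝ) ↔
      ∑ j, w j = 1 ∧ ∀ l, inner ℝ (a l) (∑ j, w j • σ j) = x l := by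
  rw [homogeneousMatrix_mulVec, Fin.cons_inj, funext_iff]

theorem homogeneousMatrix_mulVec_crossWeights (h : (homogeneousMatrix a σ).det ≠ 0) :
    (homogeneousMatrix a σ).mulVec (crossWeights a x σ) = (Fin.cons 1 x : Fin (m + 1) → ℝ) := by
  rw [crossWeights, Matrix.mulVec_mulVec, Matrix.mul_nonsing_inv _ h.isUnit, Matrix.one_mulVec]

theorem sum_crossWeights (h : (homogeneousMatrix a σ).det ≠ 0) :
    ∑ j, crossWeights a x σ j = 1 :=
  (homogeneousMatrix_mulVec_eq_iff.mp (homogeneousMatrix_mulVec_crossWeights h)).1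

theorem inner_crossPoint (h : (homogeneousMatrix a σ).det ≠ 0) (l : Fin m) :
    inner ℝ (a l) (crossPoint a x σ) = x l :=
  (homogeneousMatrix_mulVec_eq_iff.mp (homogeneousMatrix_mulVec_crossWeights h)).2 l

theorem crossWeights_eq (h : (homogeneousMatrix a σ).det ≠ 0) {w : Fin (m + 1) → ℝ}
    (hw : ∑ j, w j = 1) (hx : ∀ l, inner ℝ (a l) (∑ j, w j • σ j) = x l) :
    crossWeights a x σ = w := by
  rw [crossWeights, ← homogeneousMatrix_mulVec_eq_iff.mpr ⟨hw, hx⟩, Matrix.mulVec_mulVec,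
    Matrix.nonsing_inv_mul _ h.isUnit, Matrix.one_mulVec]

/-- Barycentric coordinates of a point of a transverse simplex are unique, so any positive ones are
the `crossWeights`. -/
theorem crossPoint_mem_openSimplex (h : (homogeneousMatrix a σ).det ≠ 0) :
    crossPoint a x σ ∈ openSimplex σ ↔ ∀ j, 0 < crossWeights a x σ j := by
  constructor
  · rintro ⟨w, hw, hs, hp⟩
    rw [crossWeights_eq h hs fun l => by rw [hp, inner_crossPoint h]]
    exact hw
  · exact fun hw => ⟨_, hw, sum_crossWeights h, rfl⟩

/-! ### Change of basis and orientation -/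

theorem exists_affine_matrix {k n : ℕ} {σ : Fin k → Space} {ρ : Fin n → Space}
    (h : ∀ i, σ i ∈ affineSpan ℝ (Set.range ρ)) :
    ∃ A : Matrix (Fin k) (Fin n) ℝ, (∀ i, ∑ j, A i j = 1) ∧ ∀ i, σ i = ∑ j, A i j • ρ j := by
  have h' : ∀ i, ∃ w : Fin n → ℝ, ∑ j, w j = 1 ∧ σ i = ∑ j, w j • ρ j := by
    intro i
    obtain ⟨w, hw, he⟩ := eq_affineCombination_of_mem_affineSpan_of_fintype (h i)
    exact ⟨w, hw, by rw [he, Finset.affineCombination_eq_linear_combination _ _ _ hw]⟩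
  choose w hw using h'
  exact ⟨Matrix.of w, fun i => (hw i).1, fun i => (hw i).2⟩

/-- The matrix whose determinant compares the orientations of two simplices. -/
def orientationMatrix {n : ℕ} (σ ρ : Fin n → Space) : Matrix (Fin n) (Fin n) ℝ :=
  Matrix.of fun i j => 1 + inner ℝ (σ i) (ρ j)

theorem orientSign_eq {n : ℕ} {σ ρ : Fin n → Space}
    (h : affineSpan ℝ (Set.range σ) = affineSpan ℝ (Set.range ρ)) :
    orientSign σ ρ = ((SignType.sign (orientationMatrix σ ρ).det : SignType) : ℤ) := by
  rw [orientSign, if_pos h]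
  rfl

/-- Rows of sum one preserve the constant homogeneous coordinate, so an affine change of vertices
acts linearly on the vectors `(σ i, 1)`. The same holds for `homogeneousMatrix_eq_mul`, where these
vectors are columns. -/
theorem orientationMatrix_eq_mul {n : ℕ} {σ ρ : Fin n → Space} (τ : Fin n → Space)
    {A : Matrix (Fin n) (Fin n) ℝ} (hA : ∀ i, ∑ j, A i j = 1)
    (h : ∀ i, σ i = ∑ j, A i j • ρ j) :
    orientationMatrix σ τ = A * orientationMatrix ρ τ := by
  ext i j
  simp only [orientationMatrix, Matrix.mul_apply, Matrix.of_apply, mul_add, mul_one,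
    Finset.sum_add_distrib, hA, h, sum_inner, real_inner_smul_left]

theorem homogeneousMatrix_eq_mul (a : Fin m → Space)
    {A : Matrix (Fin (m + 1)) (Fin (m + 1)) ℝ} (hA : ∀ i, ∑ j, A i j = 1)
    (h : ∀ i, σ i = ∑ j, A i j • ρ j) :
    homogeneousMatrix a σ = homogeneousMatrix a ρ * A.transpose := by
  ext i j
  refine Fin.cases ?_ (fun l => ?_) i
  · simp [homogeneousMatrix, Matrix.mul_apply, hA]
  · simp [homogeneousMatrix, Matrix.mul_apply, h, inner_sum, real_inner_smul_right, mul_comm]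

theorem mem_affineSpan_of_eq {n : ℕ} {σ ρ : Fin n → Space}
    (h : affineSpan ℝ (Set.range σ) = affineSpan ℝ (Set.range ρ)) (i : Fin n) :
    σ i ∈ affineSpan ℝ (Set.range ρ) :=
  h ▸ subset_affineSpan ℝ _ (Set.mem_range_self i)

theorem signType_coe_mul (s t : SignType) : ((s * t : SignType) : ℤ) = (s : ℤ) * t := by
  cases s <;> cases t <;> rfl

/-- Over a nondegenerate simplex `ρ`, orientations are compared by the change of basis matrix. -/
theorem orientSign_eq_sign_det {n : ℕ} {σ ρ : Fin n → Space} (hρ : AffineIndependent ℝ ρ)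
    (hs : affineSpan ℝ (Set.range σ) = affineSpan ℝ (Set.range ρ))
    {A : Matrix (Fin n) (Fin n) ℝ} (hA : ∀ i, ∑ j, A i j = 1)
    (h : ∀ i, σ i = ∑ j, A i j • ρ j) :
    orientSign σ ρ = ((SignType.sign A.det : SignType) : ℤ) := by
  have h1 := orientSign_self hρ
  rw [orientSign_eq rfl] at h1
  rw [orientSign_eq hs, orientationMatrix_eq_mul ρ hA h, Matrix.det_mul, sign_mul,
    signType_coe_mul, h1, mul_one]

/-- The change of basis matrix from `ρ` to `σ` factors out of the orientation matrix, and signs of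
determinants are multiplicative. -/
theorem orientSign_trans {n : ℕ} {σ ρ τ : Fin n → Space} (hρ : AffineIndependent ℝ ρ)
    (hs : affineSpan ℝ (Set.range σ) = affineSpan ℝ (Set.range ρ)) :
    orientSign σ τ = orientSign σ ρ * orientSign ρ τ := by
  by_cases ht : affineSpan ℝ (Set.range ρ) = affineSpan ℝ (Set.range τ)
  · obtain ⟨A, hA, h⟩ := exists_affine_matrix (mem_affineSpan_of_eq hs)
    rw [orientSign_eq_sign_det hρ hs hA h, orientSign_eq (hs.trans ht), orientSign_eq ht,
      orientationMatrix_eq_mul τ hA h, Matrix.det_mul, sign_mul, signType_coe_mul]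
  · rw [orientSign, if_neg (hs ▸ ht), orientSign, orientSign, if_neg ht, mul_zero]

theorem sign_det_homogeneousMatrix (a : Fin m → Space) (hρ : AffineIndependent ℝ ρ)
    (hs : affineSpan ℝ (Set.range σ) = affineSpan ℝ (Set.range ρ)) :
    ((SignType.sign (homogeneousMatrix a σ).det : SignType) : ℤ) =
      orientSign σ ρ * ((SignType.sign (homogeneousMatrix a ρ).det : SignType) : ℤ) := by
  obtain ⟨A, hA, h⟩ := exists_affine_matrix (mem_affineSpan_of_eq hs)
  rw [orientSign_eq_sign_det hρ hs hA h, homogeneousMatrix_eq_mul a hA h, Matrix.det_mul,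
    Matrix.det_transpose, mul_comm, sign_mul, signType_coe_mul]

/-- An affine relation between the vertices would be a kernel vector of the matrix. -/
theorem affineIndependent_of_det_ne_zero (h : (homogeneousMatrix a σ).det ≠ 0) :
    AffineIndependent ℝ σ := by
  rw [affineIndependent_iff]
  intro s w hw hs i hi
  have h0 : (homogeneousMatrix a σ).mulVec (fun j => if j ∈ s then w j else 0) = 0 := by
    rw [homogeneousMatrix_mulVec]
    have e1 : ∑ j, (if j ∈ s then w j else 0) = 0 := by simpa using hw
    have e2 : ∑ j, (if j ∈ s then w j else 0) • σ j = 0 := by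
      simpa [ite_smul, Finset.sum_ite_mem] using hs
    rw [e1, e2]
    funext i
    refine Fin.cases ?_ (fun l => ?_) i <;> simp
  have := congrFun (Matrix.eq_zero_of_mulVec_eq_zero h h0) i
  simpa [hi] using this

theorem affineIndependent_of_orientSign_ne_zero {n : ℕ} {σ ρ : Fin n → Space}
    (h : orientSign σ ρ ≠ 0) : AffineIndependent ℝ σ := by
  have hs : affineSpan ℝ (Set.range σ) = affineSpan ℝ (Set.range ρ) := by
    by_contra hs
    rw [orientSign, if_neg hs] at h
    exact h rfl
  have hdet : (orientationMatrix σ ρ).det ≠ 0 := by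
    intro h0
    rw [orientSign_eq hs, h0] at h
    simp at h
  rw [affineIndependent_iff]
  intro s w hw hs i hi
  have h0 : Matrix.vecMul (fun j => if j ∈ s then w j else 0) (orientationMatrix σ ρ) = 0 := by
    funext l
    have e1 : ∑ j, (if j ∈ s then w j else 0) = 0 := by simpa using hw
    have e2 : ∑ j, (if j ∈ s then w j else 0) • σ j = 0 := by
      simpa [ite_smul, Finset.sum_ite_mem] using hs
    have e3 : ∑ j, (if j ∈ s then w j else 0) * (inner ℝ (σ j) (ρ l) : ℝ) = 0 := by
      have := congrArg (fun y => inner ℝ y (ρ l)) e2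
      simpa only [sum_inner, real_inner_smul_left, inner_zero_left] using this
    simp only [Matrix.vecMul, dotProduct, orientationMatrix, Matrix.of_apply, mul_add, mul_one,
      Finset.sum_add_distrib, e1, e3, Pi.zero_apply, add_zero]
  have := congrFun (Matrix.eq_zero_of_vecMul_eq_zero hdet h0) i
  simpa [hi] using this

theorem affineSpan_eq_of_orientSign_ne_zero {n : ℕ} {σ ρ : Fin n → Space}
    (h : orientSign σ ρ ≠ 0) :
    affineSpan ℝ (Set.range σ) = affineSpan ℝ (Set.range ρ) := by
  by_contra hs
  rw [orientSign, if_neg hs] at h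
  exact h rfl

theorem openSimplex_subset_affineSpan {n : ℕ} (σ : Fin n → Space) :
    openSimplex σ ⊆ affineSpan ℝ (Set.range σ) := by
  rintro y ⟨w, -, hw, rfl⟩
  rw [← Finset.affineCombination_eq_linear_combination _ _ _ hw]
  exact affineCombination_mem_affineSpan hw _

/-- A point of the plane of `σ` is the crossing point of its fibre. -/
theorem crossPoint_eq_of_mem (h : (homogeneousMatrix a σ).det ≠ 0) {y : Space}
    (hy : y ∈ affineSpan ℝ (Set.range σ)) (hx : ∀ l, inner ℝ (a l) y = x l) :
    crossPoint a x σ = y := by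
  obtain ⟨w, hw, he⟩ := eq_affineCombination_of_mem_affineSpan_of_fintype hy
  rw [Finset.affineCombination_eq_linear_combination _ _ _ hw] at he
  rw [crossPoint, crossWeights_eq h hw fun l => by rw [← he, hx], he]

theorem crossPoint_mem_affineSpan (h : (homogeneousMatrix a σ).det ≠ 0) :
    crossPoint a x σ ∈ affineSpan ℝ (Set.range σ) := by
  have hw := sum_crossWeights (x := x) h
  rw [crossPoint, ← Finset.affineCombination_eq_linear_combination _ _ _ hw]
  exact affineCombination_mem_affineSpan hw _

open Classical in
-- The point where the fibre meets a plane depends on the plane only, and the sign changes with the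
-- orientation only. This lets one representative `ρ` serve for all simplices of its plane.
theorem crossSign_eq_of_affineSpan_eq (U : Set Space) (hρ : AffineIndependent ℝ ρ)
    (hs : affineSpan ℝ (Set.range σ) = affineSpan ℝ (Set.range ρ)) :
    crossSign a x U σ =
      if crossPoint a x ρ ∈ U ∧ crossPoint a x ρ ∈ openSimplex σ then
        orientSign σ ρ * ((SignType.sign (homogeneousMatrix a ρ).det : SignType) : ℤ)
      else 0 := by
  rw [crossSign, sign_det_homogeneousMatrix a hρ hs]
  -- If the sign vanishes, both sides are zero wherever the crossing point lies; otherwise both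
  -- simplices are transverse to the fibre.
  by_cases h0 : orientSign σ ρ * ((SignType.sign (homogeneousMatrix a ρ).det : SignType) : ℤ) = 0
  · simp [h0]
  have h1 : (homogeneousMatrix a ρ).det ≠ 0 := by
    intro h
    simp [h] at h0
  have h2 : (homogeneousMatrix a σ).det ≠ 0 := by
    intro h
    rw [← sign_det_homogeneousMatrix a hρ hs] at h0
    simp [h] at h0
  have h3 : crossPoint a x ρ = crossPoint a x σ :=
    crossPoint_eq_of_mem h1 (hs ▸ crossPoint_mem_affineSpan h2) fun l => inner_crossPoint h2 l
  simp only [h3, crossPoint_mem_openSimplex h2, and_comm]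

end

/-! ### Representatives of the planes of a chain -/

section

variable {G : Type*} [NormedAddCommGroup G]

/-- `R` contains one nondegenerate simplex for every plane that is spanned by a nondegenerate
simplex of `c`. -/
structure RepresentsPlanes {n : ℕ} (c : SimplexChain G n) (R : Finset (Fin n → Space)) :
    Prop where
  affineIndependent : ∀ ρ ∈ R, AffineIndependent ℝ ρ
  injOn : ∀ ρ ∈ R, ∀ ρ' ∈ R,
    affineSpan ℝ (Set.range ρ) = affineSpan ℝ (Set.range ρ') → ρ = ρ'
  exists_mem : ∀ σ ∈ c.support, AffineIndependent ℝ σ →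
    ∃ ρ ∈ R, affineSpan ℝ (Set.range σ) = affineSpan ℝ (Set.range ρ)

theorem exists_representsPlanes {n : ℕ} (c : SimplexChain G n) :
    ∃ R, RepresentsPlanes c R := by
  classical
  let S := c.support.filter fun σ => AffineIndependent ℝ σ
  let sp : (Fin n → Space) → AffineSubspace ℝ Space := fun σ => affineSpan ℝ (Set.range σ)
  have h : ∀ E ∈ S.image sp, ∃ σ ∈ S, sp σ = E := fun E hE => Finset.mem_image.mp hE
  choose! f hf using h
  refine ⟨(S.image sp).image f, ?_, ?_, ?_⟩
  · intro ρ hρ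
    obtain ⟨E, hE, rfl⟩ := Finset.mem_image.mp hρ
    exact (Finset.mem_filter.mp (hf E hE).1).2
  · intro ρ hρ ρ' hρ' he
    obtain ⟨E, hE, rfl⟩ := Finset.mem_image.mp hρ
    obtain ⟨E', hE', rfl⟩ := Finset.mem_image.mp hρ'
    change sp _ = sp _ at he
    rw [(hf E hE).2, (hf E' hE').2] at he
    rw [he]
  · intro σ hσ hi
    have hm : sp σ ∈ S.image sp := Finset.mem_image_of_mem _ (Finset.mem_filter.mpr ⟨hσ, hi⟩)
    exact ⟨f (sp σ), Finset.mem_image_of_mem _ hm, (hf _ hm).2.symm⟩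

open Classical in
-- Grouping the simplices by planes turns the intersection number into a sum of multiplicities,
-- which is what the mass measures. Each nondegenerate simplex belongs to exactly one
-- representative; degenerate ones contribute zero to both sides.
theorem crossing_eq_sum_multiplicity {m : ℕ} {c : SimplexChain G (m + 1)}
    {R : Finset (Fin (m + 1) → Space)} (hR : RepresentsPlanes c R) (a : Fin m → Space)
    (x : Fin m → ℝ) (U : Set Space) :
    crossing a x U c = ∑ ρ ∈ R, if crossPoint a x ρ ∈ U then
      ((SignType.sign (homogeneousMatrix a ρ).det : SignType) : ℤ) •
        multiplicity ρ (crossPoint a x ρ) c else 0 := by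
  have h1 : ∀ ρ, (if crossPoint a x ρ ∈ U then
      ((SignType.sign (homogeneousMatrix a ρ).det : SignType) : ℤ) •
        multiplicity ρ (crossPoint a x ρ) c else 0) =
      ∑ σ ∈ c.support, (if crossPoint a x ρ ∈ U ∧ crossPoint a x ρ ∈ openSimplex σ then
        orientSign σ ρ * ((SignType.sign (homogeneousMatrix a ρ).det : SignType) : ℤ)
      else 0) • c σ := by
    intro ρ
    rw [multiplicity_eq_sum]
    by_cases hU : crossPoint a x ρ ∈ U
    · simp only [hU, if_true, true_and, Finset.smul_sum]
      refine Finset.sum_congr rfl fun σ _ => ?_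
      split_ifs
      · rw [smul_smul, mul_comm]
      · simp
    · simp [hU]
  simp only [h1]
  rw [Finset.sum_comm, crossing_eq_sum]
  refine Finset.sum_congr rfl fun σ hσ => ?_
  by_cases hi : AffineIndependent ℝ σ
  · obtain ⟨ρ, hρ, hs⟩ := hR.exists_mem σ hσ hi
    rw [Finset.sum_eq_single_of_mem ρ hρ,
      crossSign_eq_of_affineSpan_eq U (hR.affineIndependent ρ hρ) hs]
    intro ρ' hρ' hne
    have : orientSign σ ρ' = 0 := by
      by_contra h0
      exact hne (hR.injOn ρ' hρ' ρ hρ ((affineSpan_eq_of_orientSign_ne_zero h0).symm.trans hs))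
    simp [this]
  · have h0 : (homogeneousMatrix a σ).det = 0 := by
      by_contra h0
      exact hi (affineIndependent_of_det_ne_zero h0)
    rw [Finset.sum_eq_zero]
    · simp [crossSign, h0]
    · intro ρ _
      have : orientSign σ ρ = 0 := by
        by_contra h0
        exact hi (affineIndependent_of_orientSign_ne_zero h0)
      simp [this]

theorem multiplicity_eq_zero_of_notMem {n : ℕ} (c : SimplexChain G n) {ρ : Fin n → Space}
    {y : Space} (hy : y ∉ affineSpan ℝ (Set.range ρ)) : multiplicity ρ y c = 0 := by
  classical
  rw [multiplicity_eq_sum]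
  refine Finset.sum_eq_zero fun σ _ => ?_
  split_ifs with h
  · have : orientSign σ ρ = 0 := by
      by_contra h0
      exact hy (affineSpan_eq_of_orientSign_ne_zero h0 ▸ openSimplex_subset_affineSpan σ h)
    simp [this]
  · rfl

/-- By `orientSign_trans`, the multiplicity along any oriented plane that carries a nonzero one is a
sign times the multiplicity along the representative of the same plane. -/
theorem absMultiplicity_le_sum {n : ℕ} {c : SimplexChain G n} {R : Finset (Fin n → Space)}
    (hR : RepresentsPlanes c R) (y : Space) :
    absMultiplicity c y ≤ ∑ ρ ∈ R, ‖multiplicity ρ y c‖ₑ := by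
  classical
  refine iSup_le fun τ => ?_
  by_cases h : ∃ σ ∈ c.support, orientSign σ τ ≠ 0
  · obtain ⟨σ, hσ, h0⟩ := h
    obtain ⟨ρ, hρ, hs⟩ := hR.exists_mem σ hσ (affineIndependent_of_orientSign_ne_zero h0)
    have hτ := affineSpan_eq_of_orientSign_ne_zero h0
    have key : multiplicity τ y c = orientSign ρ τ • multiplicity ρ y c := by
      rw [multiplicity_eq_sum, multiplicity_eq_sum, Finset.smul_sum]
      refine Finset.sum_congr rfl fun σ' _ => ?_
      split_ifs
      · by_cases hs' : affineSpan ℝ (Set.range σ') = affineSpan ℝ (Set.range ρ)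
        · rw [orientSign_trans (hR.affineIndependent ρ hρ) hs', smul_smul, mul_comm]
        · have e1 : orientSign σ' τ = 0 := if_neg (by rwa [← hτ, hs])
          have e2 : orientSign σ' ρ = 0 := if_neg hs'
          simp [e1, e2]
      · simp
    rw [key]
    exact (enorm_sign_smul_le ρ τ _).trans
      (Finset.single_le_sum (f := fun ρ => ‖multiplicity ρ y c‖ₑ) (fun _ _ => zero_le) hρ)
  · push Not at h
    rw [multiplicity_eq_sum, Finset.sum_eq_zero]
    · simp
    · intro σ hσ
      simp [h σ hσ]

end

/-! ### Isometric parametrizations of planes -/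

section

variable {m : ℕ}

/-- The parametrization of the plane through `p` with the directions `e`. -/
def planeMap (p : Space) (e : Fin m → Space) : (Fin m → ℝ) →ᵃ[ℝ] Space :=
  (Fintype.linearCombination ℝ e).toAffineMap + AffineMap.const ℝ (Fin m → ℝ) p

theorem planeMap_apply (p : Space) (e : Fin m → Space) (t : Fin m → ℝ) :
    planeMap p e t = ∑ j, t j • e j + p := by
  simp [planeMap, Fintype.linearCombination_apply]

theorem continuous_planeMap (p : Space) (e : Fin m → Space) : Continuous (planeMap p e) :=
  AffineMap.continuous_of_finiteDimensional _

theorem add_mem_affineSpan_iff (ρ : Fin (m + 1) → Space) (v : Space) :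
    v + ρ 0 ∈ affineSpan ℝ (Set.range ρ) ↔ v ∈ vectorSpan ℝ (Set.range ρ) := by
  have h0 : ρ 0 ∈ affineSpan ℝ (Set.range ρ) := subset_affineSpan ℝ _ (Set.mem_range_self 0)
  have h := AffineSubspace.vadd_mem_iff_mem_direction v h0
  rwa [direction_affineSpan] at h

theorem exists_orthonormal_range_planeMap {ρ : Fin (m + 1) → Space}
    (hρ : AffineIndependent ℝ ρ) : ∃ e : Fin m → Space, Orthonormal ℝ e ∧
      Set.range (planeMap (ρ 0) e) = affineSpan ℝ (Set.range ρ) := by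
  have hfr : Module.finrank ℝ (vectorSpan ℝ (Set.range ρ)) = m :=
    hρ.finrank_vectorSpan (by simp)
  let b := (stdOrthonormalBasis ℝ (vectorSpan ℝ (Set.range ρ))).reindex (finCongr hfr)
  have key := add_mem_affineSpan_iff ρ
  refine ⟨fun j => (b j : Space), b.orthonormal.comp_linearIsometry (Submodule.subtypeₗᵢ _), ?_⟩
  ext y
  constructor
  · rintro ⟨t, rfl⟩
    rw [planeMap_apply]
    exact (key _).mpr (Submodule.sum_mem _ fun j _ => Submodule.smul_mem _ _ (b j).2)
  · intro hy
    have hv : y - ρ 0 ∈ vectorSpan ℝ (Set.range ρ) := by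
      rw [← key, sub_add_cancel]
      exact hy
    refine ⟨fun j => b.repr ⟨_, hv⟩ j, ?_⟩
    have := congrArg (Subtype.val) (b.sum_repr ⟨_, hv⟩)
    rw [planeMap_apply]
    simp only [Submodule.coe_sum, Submodule.coe_smul] at this
    rw [this, sub_add_cancel]

/-- Orthonormal directions make the parametrization an isometry for the Euclidean norm, for which
`μHE[m]` is Lebesgue measure. As `Fin m → ℝ` carries the sup norm, the isometry has to start from
`EuclideanSpace`. -/
theorem map_planeMap_volume (p : Space) {e : Fin m → Space} (he : Orthonormal ℝ e) :
    (volume : Measure (Fin m → ℝ)).map (planeMap p e) =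
      (μHE[m] : Measure Space).restrict (Set.range (planeMap p e)) := by
  have hiso : Isometry fun t : EuclideanSpace ℝ (Fin m) => planeMap p e t.ofLp := by
    refine Isometry.of_dist_eq fun s t => ?_
    rw [dist_eq_norm, dist_eq_norm, planeMap_apply, planeMap_apply, add_sub_add_right_eq_sub,
      ← Finset.sum_sub_distrib]
    simp only [← sub_smul]
    have h1 := he.inner_sum (fun j => s j - t j) (fun j => s j - t j) Finset.univ
    rw [real_inner_self_eq_norm_sq] at h1
    have h2 : ‖s - t‖ ^ 2 = ∑ j, (s j - t j) * (s j - t j) := by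
      rw [EuclideanSpace.real_norm_sq_eq]
      exact Finset.sum_congr rfl fun j _ => sq _
    have h3 : ‖∑ j, (s j - t j) • e j‖ ^ 2 = ‖s - t‖ ^ 2 := by
      rw [h1, h2]
      rfl
    exact (sq_eq_sq₀ (norm_nonneg _) (norm_nonneg _)).mp h3
  have h := hiso.map_euclideanHausdorffMeasure (d := m)
  rw [EuclideanSpace.euclideanHausdorffMeasure_eq_volume,
    ← (PiLp.volume_preserving_toLp (Fin m)).map_eq, Measure.map_map hiso.continuous.measurable
      (PiLp.volume_preserving_toLp (Fin m)).measurable] at h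
  have hr : Set.range (fun t : EuclideanSpace ℝ (Fin m) => planeMap p e t.ofLp) =
      Set.range (planeMap p e) := by
    ext y
    constructor
    · rintro ⟨t, rfl⟩
      exact ⟨_, rfl⟩
    · rintro ⟨t, rfl⟩
      exact ⟨WithLp.toLp 2 t, rfl⟩
  rw [hr] at h
  exact h

theorem eq_of_affineSpan_le {ρ ρ' : Fin (m + 1) → Space} (hρ : AffineIndependent ℝ ρ)
    (hρ' : AffineIndependent ℝ ρ')
    (h : affineSpan ℝ (Set.range ρ) ≤ affineSpan ℝ (Set.range ρ')) :
    affineSpan ℝ (Set.range ρ) = affineSpan ℝ (Set.range ρ') := by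
  refine AffineSubspace.eq_of_direction_eq_of_nonempty_of_le ?_
    ⟨ρ 0, subset_affineSpan ℝ _ (Set.mem_range_self 0)⟩ h
  refine Submodule.eq_of_le_of_finrank_eq (AffineSubspace.direction_le h) ?_
  rw [direction_affineSpan, direction_affineSpan, hρ.finrank_vectorSpan (n := m) (by simp),
    hρ'.finrank_vectorSpan (n := m) (by simp)]

/-- In coordinates of the first plane the second one is a proper affine subspace, since distinct
planes of equal dimension do not contain each other. -/
theorem measure_affineSpan_inter {ρ ρ' : Fin (m + 1) → Space} (hρ : AffineIndependent ℝ ρ)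
    (hρ' : AffineIndependent ℝ ρ')
    (h : affineSpan ℝ (Set.range ρ) ≠ affineSpan ℝ (Set.range ρ')) :
    (μHE[m] : Measure Space) ((affineSpan ℝ (Set.range ρ) : Set Space) ∩
      affineSpan ℝ (Set.range ρ')) = 0 := by
  obtain ⟨e, he, hr⟩ := exists_orthonormal_range_planeMap hρ
  have hm : MeasurableSet (affineSpan ℝ (Set.range ρ') : Set Space) :=
    (AffineSubspace.closed_of_finiteDimensional _).measurableSet
  rw [Set.inter_comm, ← Measure.restrict_apply hm, ← hr, ← map_planeMap_volume _ he,
    Measure.map_apply (continuous_planeMap _ _).measurable hm]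
  refine Measure.addHaar_affineSubspace volume
    (AffineSubspace.comap (planeMap (ρ 0) e) (affineSpan ℝ (Set.range ρ'))) fun ht => h ?_
  refine eq_of_affineSpan_le hρ hρ' fun y hy => ?_
  rw [← SetLike.mem_coe, ← hr] at hy
  obtain ⟨t, rfl⟩ := hy
  have : t ∈ AffineSubspace.comap (planeMap (ρ 0) e) (affineSpan ℝ (Set.range ρ')) := by
    rw [ht]
    exact AffineSubspace.mem_top ℝ _ t
  exact this

/-! ### The area formula on a plane -/

/-- The matrix, in the directions `e`, of the linear map with rows `a`. -/
def frameMatrix (a e : Fin m → Space) : Matrix (Fin m) (Fin m) ℝ :=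
  Matrix.of fun l j => inner ℝ (a l) (e j)

theorem inner_planeMap (a : Fin m → Space) (p : Space) (e : Fin m → Space) (t : Fin m → ℝ)
    (l : Fin m) :
    inner ℝ (a l) (planeMap p e t) = (frameMatrix a e).mulVec t l + inner ℝ (a l) p := by
  rw [planeMap_apply, inner_add_right, inner_sum]
  simp [frameMatrix, Matrix.mulVec, dotProduct, real_inner_smul_right, mul_comm]

variable {ρ : Fin (m + 1) → Space} {e : Fin m → Space}

/-- Both determinants test whether the linear map with rows `a` is injective on the plane. -/
theorem det_homogeneousMatrix_ne_zero_iff (hρ : AffineIndependent ℝ ρ)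
    (hr : Set.range (planeMap (ρ 0) e) = affineSpan ℝ (Set.range ρ)) (he : Orthonormal ℝ e)
    (a : Fin m → Space) : (homogeneousMatrix a ρ).det ≠ 0 ↔ (frameMatrix a e).det ≠ 0 := by
  constructor
  · intro h h0
    obtain ⟨t, ht, h1⟩ := Matrix.exists_mulVec_eq_zero_iff.mpr h0
    have h2 : ∀ l, inner ℝ (a l) (planeMap (ρ 0) e t) = inner ℝ (a l) (ρ 0) := fun l => by
      rw [inner_planeMap, h1, Pi.zero_apply, zero_add]
    have h3 := crossPoint_eq_of_mem h (x := fun l => inner ℝ (a l) (ρ 0))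
      (hr ▸ Set.mem_range_self t : planeMap (ρ 0) e t ∈ (affineSpan ℝ (Set.range ρ) : Set Space)) h2
    have h4 := crossPoint_eq_of_mem h (x := fun l => inner ℝ (a l) (ρ 0))
      (subset_affineSpan ℝ _ (Set.mem_range_self 0)) fun l => rfl
    rw [h3, planeMap_apply, add_eq_right] at h4
    exact ht (funext (Fintype.linearIndependent_iff.mp he.linearIndependent t h4))
  · intro h h0
    obtain ⟨w, hw, h1⟩ := Matrix.exists_mulVec_eq_zero_iff.mpr h0
    rw [homogeneousMatrix_mulVec] at h1
    have hs : ∑ j, w j = 0 := congrFun h1 0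
    have hl : ∀ l, inner ℝ (a l) (∑ j, w j • ρ j) = 0 := fun l => congrFun h1 l.succ
    have hmem : (∑ j, w j • ρ j) + ρ 0 ∈ (affineSpan ℝ (Set.range ρ) : Set Space) := by
      rw [SetLike.mem_coe, add_mem_affineSpan_iff,
        ← Finset.weightedVSub_eq_linear_combination Finset.univ hs]
      exact weightedVSub_mem_vectorSpan hs ρ
    rw [← hr] at hmem
    obtain ⟨t, ht⟩ := hmem
    rw [planeMap_apply, add_left_inj] at ht
    have ht0 : t = 0 := by
      refine Matrix.eq_zero_of_mulVec_eq_zero h (funext fun l => ?_)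
      have := inner_planeMap a 0 e t l
      rw [planeMap_apply, add_zero, ht, hl, inner_zero_right, add_zero] at this
      exact this.symm
    rw [ht0] at ht
    refine hw (funext fun j => ?_)
    exact (affineIndependent_iff.mp hρ) Finset.univ w hs (by rw [← ht]; simp) j (Finset.mem_univ j)

theorem continuous_crossPoint (a : Fin m → Space) (σ : Fin (m + 1) → Space) :
    Continuous fun x => crossPoint a x σ := by
  unfold crossPoint crossWeights
  have h1 : Continuous fun x : Fin m → ℝ => (Fin.cons 1 x : Fin (m + 1) → ℝ) := by
    refine continuous_pi fun i => ?_
    refine Fin.cases ?_ (fun l => ?_) i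
    · simpa using continuous_const
    · simpa using continuous_apply l
  have h2 : ∀ j, Continuous fun x : Fin m → ℝ =>
      (homogeneousMatrix a σ)⁻¹.mulVec (Fin.cons 1 x) j := fun j =>
    (continuous_apply j).comp (Continuous.matrix_mulVec continuous_const h1)
  exact continuous_finsetSum _ fun j _ => (h2 j).smul continuous_const

/-- `crossPoint` inverts the affine map that the rows `a` induce on the parametrized plane, so this
is the linear change of variables with Jacobian `|det (frameMatrix a e)|`. -/
theorem lintegral_crossPoint
    (hρ : AffineIndependent ℝ ρ)
    (hr : Set.range (planeMap (ρ 0) e) = affineSpan ℝ (Set.range ρ)) (he : Orthonormal ℝ e)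
    (a : Fin m → Space) (h : (homogeneousMatrix a ρ).det ≠ 0) {F : Space → ℝ≥0∞}
    (hF : Measurable F) :
    ∫⁻ x, F (crossPoint a x ρ) = ENNReal.ofReal |(frameMatrix a e).det| *
      ∫⁻ y in affineSpan ℝ (Set.range ρ), F y ∂(μHE[m] : Measure Space) := by
  have hdet := (det_homogeneousMatrix_ne_zero_iff hρ hr he a).mp h
  set b : Fin m → ℝ := fun l => inner ℝ (a l) (ρ 0)
  have hm : Measurable fun x => F (crossPoint a (x + b) ρ) :=
    hF.comp ((continuous_crossPoint a ρ).measurable.comp (measurable_id.add_const b))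
  have key : ∀ t, crossPoint a (Matrix.toLin' (frameMatrix a e) t + b) ρ = planeMap (ρ 0) e t := by
    intro t
    refine crossPoint_eq_of_mem h (hr ▸ Set.mem_range_self t :
      planeMap (ρ 0) e t ∈ (affineSpan ℝ (Set.range ρ) : Set Space)) fun l => ?_
    rw [inner_planeMap]
    rfl
  rw [← hr, ← map_planeMap_volume _ he, lintegral_map hF (continuous_planeMap _ _).measurable,
    ← lintegral_add_right_eq_self (fun x => F (crossPoint a x ρ)) b]
  have h1 := congrArg (fun μ => ∫⁻ x, F (crossPoint a (x + b) ρ) ∂μ)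
    (Real.map_matrix_volume_pi_eq_smul_volume_pi hdet)
  simp only [lintegral_smul_measure] at h1
  rw [lintegral_map hm (LinearMap.continuous_of_finiteDimensional _).measurable] at h1
  simp only [key] at h1
  rw [h1, smul_eq_mul, ← mul_assoc, ← ENNReal.ofReal_mul (abs_nonneg _), ← abs_mul,
    mul_inv_cancel₀ hdet, abs_one, ENNReal.ofReal_one, one_mul]

end

/-! ### The mass as a sum over planes -/

section

variable {G : Type*} [NormedAddCommGroup G]

/-- The multiplicity depends only on which of the finitely many simplices contain the point.
Factoring through this pattern avoids any measurable structure on `G`. -/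
theorem measurable_enorm_multiplicity {n : ℕ} (ρ : Fin n → Space) (c : SimplexChain G n) :
    Measurable fun x => ‖multiplicity ρ x c‖ₑ := by
  classical
  let F : (c.support → Prop) → ℝ≥0∞ := fun p =>
    ‖∑ σ : c.support, if p σ then orientSign (σ : Fin n → Space) ρ • c σ else 0‖ₑ
  have h : (fun x => ‖multiplicity ρ x c‖ₑ) =
      F ∘ fun x (σ : c.support) => x ∈ openSimplex (σ : Fin n → Space) := by
    funext x
    simp only [F, Function.comp]
    rw [multiplicity_eq_sum, ← Finset.sum_coe_sort]
  rw [h]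
  refine (measurable_of_finite F).comp (measurable_pi_lambda _ fun σ => ?_)
  exact measurable_mem.mpr (measurableSet_openSimplex _)

/-- Almost every point lies on at most one of the planes, so the supremum in `absMultiplicity` is a
sum with at most one nonzero term there. -/
theorem simplexMass_eq_sum {m : ℕ} {c : SimplexChain G (m + 1)}
    {R : Finset (Fin (m + 1) → Space)} (hR : RepresentsPlanes c R) :
    simplexMass c = ∑ ρ ∈ R, ∫⁻ y in affineSpan ℝ (Set.range ρ), ‖multiplicity ρ y c‖ₑ
      ∂(μHE[m] : Measure Space) := by
  have h1 : ∀ ρ, ∫⁻ y in affineSpan ℝ (Set.range ρ), ‖multiplicity ρ y c‖ₑ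
      ∂(μHE[m] : Measure Space) = ∫⁻ y, ‖multiplicity ρ y c‖ₑ ∂(μHE[m] : Measure Space) := by
    intro ρ
    refine setLIntegral_eq_of_support_subset fun y hy => ?_
    by_contra hy'
    exact hy (by simp [multiplicity_eq_zero_of_notMem c hy'])
  simp only [h1]
  rw [← lintegral_finsetSum _ fun ρ _ => measurable_enorm_multiplicity ρ c, simplexMass,
    Nat.add_sub_cancel]
  have hae : ∀ᵐ y ∂(μHE[m] : Measure Space), ∀ ρ ∈ R, ∀ ρ' ∈ R, ρ ≠ ρ' →
      ¬ (y ∈ affineSpan ℝ (Set.range ρ) ∧ y ∈ affineSpan ℝ (Set.range ρ')) := by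
    rw [Finset.eventually_all]
    intro ρ hρ
    rw [Finset.eventually_all]
    intro ρ' hρ'
    by_cases h : ρ = ρ'
    · simp [h]
    · filter_upwards [measure_eq_zero_iff_ae_notMem.mp
        (measure_affineSpan_inter (hR.affineIndependent ρ hρ) (hR.affineIndependent ρ' hρ')
          fun he => h (hR.injOn ρ hρ ρ' hρ' he))] with y hy _
      exact hy
  refine lintegral_congr_ae ?_
  filter_upwards [hae] with y hy
  refine le_antisymm (absMultiplicity_le_sum hR y) ?_
  by_cases h : ∃ ρ ∈ R, y ∈ affineSpan ℝ (Set.range ρ)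
  · obtain ⟨ρ, hρ, hyρ⟩ := h
    rw [Finset.sum_eq_single_of_mem ρ hρ fun τ hτ hτρ => ?_]
    · exact le_iSup (fun ρ => ‖multiplicity ρ y c‖ₑ) ρ
    · rw [multiplicity_eq_zero_of_notMem c fun hyτ => hy τ hτ ρ hρ hτρ ⟨hyτ, hyρ⟩, enorm_zero]
  · push Not at h
    rw [Finset.sum_eq_zero fun ρ hρ => by
      rw [multiplicity_eq_zero_of_notMem c (h ρ hρ), enorm_zero]]
    exact zero_le

end

/-! ### The boundary and intersection numbers with half spaces -/

section

variable {ι : Type*} [Fintype ι]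

theorem pos_add_mul_iff_of_pos {w n t : ℝ} (hn : 0 < n) : 0 < w + t * n ↔ -w / n < t := by
  rw [div_lt_iff₀ hn]
  constructor <;> intro h <;> linarith

theorem pos_add_mul_iff_of_neg {w n t : ℝ} (hn : n < 0) : 0 < w + t * n ↔ t < -w / n := by
  rw [lt_div_iff_of_neg hn]
  constructor <;> intro h <;> linarith

/-- A nonempty bounded interval that is cut out by affine functions in general position has exactly
two endpoints. -/
theorem exists_endpoints {w n : ι → ℝ} (hs : ∑ i, n i = 0) (h0 : n ≠ 0)
    (hg : ∀ i j, i ≠ j → n i ≠ 0 → n j ≠ 0 → -w i / n i ≠ -w j / n j)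
    (hT : ∃ t, ∀ j, 0 < w j + t * n j) :
    ∃ p q, 0 < n p ∧ n q < 0 ∧ -w p / n p < -w q / n q ∧
      (∀ j, j ≠ p → 0 < w j + -w p / n p * n j) ∧
      (∀ j, j ≠ q → 0 < w j + -w q / n q * n j) ∧
      (∀ i, n i ≠ 0 → (∀ j, j ≠ i → 0 < w j + -w i / n i * n j) → i = p ∨ i = q) ∧
      ∀ t, (∀ j, 0 < w j + t * n j) ↔ -w p / n p < t ∧ t < -w q / n q := by
  classical
  obtain ⟨t0, ht0⟩ := hT
  obtain ⟨i0, hi0⟩ : ∃ i, n i ≠ 0 := by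
    by_contra! h
    exact h0 (funext h)
  have hP : (Finset.univ.filter fun i => 0 < n i).Nonempty := by
    obtain ⟨i, hi, hp⟩ := Finset.exists_pos_of_sum_zero_of_exists_nonzero n hs
      ⟨i0, Finset.mem_univ _, hi0⟩
    exact ⟨i, by simpa using hp⟩
  have hN : (Finset.univ.filter fun i => n i < 0).Nonempty := by
    obtain ⟨i, hi, hp⟩ := Finset.exists_pos_of_sum_zero_of_exists_nonzero (fun i => -n i)
      (by rw [Finset.sum_neg_distrib, hs, neg_zero]) ⟨i0, Finset.mem_univ _, neg_ne_zero.mpr hi0⟩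
    exact ⟨i, by simpa using hp⟩
  -- A function with `n i > 0` bounds `t` below by its root `-w i / n i`, one with `n i < 0` bounds
  -- it above. The endpoints are the largest lower and the smallest upper bound; general position
  -- makes them strict.
  obtain ⟨p, hp, hpm⟩ := Finset.exists_max_image _ (fun i => -w i / n i) hP
  obtain ⟨q, hq, hqm⟩ := Finset.exists_min_image _ (fun i => -w i / n i) hN
  simp only [Finset.mem_filter, Finset.mem_univ, true_and] at hp hpm hq hqm
  have h1 : -w p / n p < t0 := (pos_add_mul_iff_of_pos hp).mp (ht0 p)
  have h2 : t0 < -w q / n q := (pos_add_mul_iff_of_neg hq).mp (ht0 q)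
  have hz : ∀ j t, n j = 0 → 0 < w j + t * n j := fun j t hj => by
    have := ht0 j
    rw [hj, mul_zero] at this ⊢
    exact this
  refine ⟨p, q, hp, hq, h1.trans h2, ?_, ?_, ?_, ?_⟩
  · intro j hj
    rcases lt_trichotomy (n j) 0 with h | h | h
    · exact (pos_add_mul_iff_of_neg h).mpr ((h1.trans h2).trans_le (hqm j h))
    · exact hz j _ h
    · exact (pos_add_mul_iff_of_pos h).mpr (lt_of_le_of_ne (hpm j h) (hg j p hj h.ne' hp.ne'))
  · intro j hj
    rcases lt_trichotomy (n j) 0 with h | h | h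
    · exact (pos_add_mul_iff_of_neg h).mpr
        (lt_of_le_of_ne (hqm j h) (hg j q hj h.ne hq.ne).symm)
    · exact hz j _ h
    · exact (pos_add_mul_iff_of_pos h).mpr ((hpm j h).trans_lt (h1.trans h2))
  · intro i hi hv
    rcases lt_or_gt_of_ne hi with h | h
    · refine Or.inr ?_
      by_contra hne
      exact absurd ((pos_add_mul_iff_of_neg hq).mp (hv q (Ne.symm hne))) (not_lt.mpr (hqm i h))
    · refine Or.inl ?_
      by_contra hne
      exact absurd ((pos_add_mul_iff_of_pos hp).mp (hv p (Ne.symm hne))) (not_lt.mpr (hpm i h))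
  · intro t
    refine ⟨fun h => ⟨(pos_add_mul_iff_of_pos hp).mp (h p), (pos_add_mul_iff_of_neg hq).mp (h q)⟩,
      fun h j => ?_⟩
    rcases lt_trichotomy (n j) 0 with hj | hj | hj
    · exact (pos_add_mul_iff_of_neg hj).mpr (h.2.trans_le (hqm j hj))
    · exact hz j _ hj
    · exact (pos_add_mul_iff_of_pos hj).mpr ((hpm j hj).trans_lt h.1)

/-- Move slightly away from the root, to the side where the `i`-th function is positive; the others
stay positive by continuity. -/
theorem exists_forall_pos_of_endpoint {w n : ι → ℝ} {i : ι} (hi : n i ≠ 0)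
    (hv : ∀ j, j ≠ i → 0 < w j + -w i / n i * n j) : ∃ t, ∀ j, 0 < w j + t * n j := by
  have hc : ∀ j, j ≠ i → ∀ᶠ t in 𝓝 (-w i / n i), 0 < w j + t * n j := fun j hj =>
    (by fun_prop : Continuous fun t => w j + t * n j).continuousAt.eventually (lt_mem_nhds (hv j hj))
  rcases lt_or_gt_of_ne hi with h | h
  · have : ∀ᶠ t in 𝓝[<] (-w i / n i), ∀ j, 0 < w j + t * n j := by
      rw [eventually_all]
      intro j
      by_cases hj : j = i
      · subst hj
        filter_upwards [self_mem_nhdsWithin] with t ht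
        exact (pos_add_mul_iff_of_neg h).mpr ht
      · exact (hc j hj).filter_mono nhdsWithin_le_nhds
    exact this.exists
  · have : ∀ᶠ t in 𝓝[>] (-w i / n i), ∀ j, 0 < w j + t * n j := by
      rw [eventually_all]
      intro j
      by_cases hj : j = i
      · subst hj
        filter_upwards [self_mem_nhdsWithin] with t ht
        exact (pos_add_mul_iff_of_pos h).mpr ht
      · exact (hc j hj).filter_mono nhdsWithin_le_nhds
    exact this.exists

open Classical in
/-- The fundamental theorem of calculus for the indicator function of a half line, on the interval
cut out by affine functions in general position. -/
theorem sum_sign_endpoints {w n : ι → ℝ} (hs : ∑ i, n i = 0) (h0 : n ≠ 0)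
    (hg : ∀ i j, i ≠ j → n i ≠ 0 → n j ≠ 0 → -w i / n i ≠ -w j / n j) {b D r : ℝ}
    (hr : ∀ i, n i ≠ 0 → r ≠ b + -w i / n i * D) :
    ∑ i, (if (∀ j, j ≠ i → 0 < w j + -w i / n i * n j) ∧ b + -w i / n i * D < r then
        ((SignType.sign (n i) : SignType) : ℤ) else 0) =
      if ∀ j, 0 < w j + (r - b) / D * n j then ((SignType.sign D : SignType) : ℤ) else 0 := by
  by_cases hT : ∃ t, ∀ j, 0 < w j + t * n j
  · obtain ⟨p, q, hp, hq, hpq, hvp, hvq, huniq, hchar⟩ := exists_endpoints hs h0 hg hT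
    have hne : p ≠ q := by
      rintro rfl
      exact lt_asymm hp hq
    rw [Fintype.sum_eq_add p q hne]
    · simp only [hchar, sign_pos hp, sign_neg hq]
      rw [if_congr (and_iff_right hvp) rfl rfl, if_congr (and_iff_right hvq) rfl rfl]
      have hrp := hr p hp.ne'
      have hrq := hr q hq.ne
      generalize -w p / n p = P at *
      generalize -w q / n q = Q at *
      -- The sum is now the indicator of `b + P * D < r` minus that of `b + Q * D < r`. It is
      -- nonzero exactly when `r` separates the two heights, with the sign of `D`; for `D = 0` the
      -- terms cancel.
      rcases lt_trichotomy D 0 with hD | hD | hD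
      · simp only [lt_div_iff_of_neg hD, div_lt_iff_of_neg hD, sign_neg hD]
        have h1 : Q * D < P * D := mul_lt_mul_of_neg_right hpq hD
        rcases lt_or_gt_of_ne hrp with h2 | h2
        · rw [if_neg (by linarith)]
          split_ifs with h3 h4 h4
          · rfl
          · exact absurd ⟨by linarith, by linarith⟩ h4
          · exact absurd (lt_of_le_of_ne (not_lt.mp h3) hrq) (by linarith [h4.2])
          · rfl
        · rw [if_pos h2, if_pos (by linarith), if_neg fun h => by linarith [h.1]]
          rfl
      · subst hD
        simp
        split_ifs <;> rfl
      · simp only [lt_div_iff₀ hD, div_lt_iff₀ hD, sign_pos hD]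
        have h1 : P * D < Q * D := mul_lt_mul_of_pos_right hpq hD
        rcases lt_or_gt_of_ne hrq with h2 | h2
        · rw [if_neg (by linarith : ¬ b + Q * D < r), add_zero]
          refine if_congr ⟨fun h => ⟨by linarith, by linarith⟩, fun h => by linarith [h.1]⟩ rfl rfl
        · rw [if_pos h2, if_pos (by linarith), if_neg fun h => by linarith [h.2]]
          rfl
    · rintro i ⟨hip, hiq⟩
      by_cases hi : n i = 0
      · simp [hi]
      · rw [if_neg]
        rintro ⟨hv, -⟩
        rcases huniq i hi hv with h | h
        · exact hip h
        · exact hiq h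
  · rw [if_neg fun h => hT ⟨_, h⟩]
    refine Finset.sum_eq_zero fun i _ => ?_
    by_cases hi : n i = 0
    · simp [hi]
    · exact if_neg fun h => hT (exists_forall_pos_of_endpoint hi h.1)

end

/-! ### Fibres in a simplex and in its faces -/

section

variable {m : ℕ}

/-- The face of a simplex opposite to the vertex `i`. -/
def face {n : ℕ} (τ : Fin (n + 1) → Space) (i : Fin (n + 1)) : Fin n → Space :=
  fun j => τ (i.succAbove j)

/-- The signed minors that span the kernel of the homogeneous coordinates of `τ`. -/
def faceMinor (a : Fin m → Space) (τ : Fin (m + 2) → Space) (i : Fin (m + 2)) : ℝ :=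
  (-1) ^ (i : ℕ) * (homogeneousMatrix a (face τ i)).det

/-- Laplace expansion of the determinant of the homogeneous coordinates with row `l` repeated on
top. -/
theorem sum_faceMinor_mul (a : Fin m → Space) (τ : Fin (m + 2) → Space) (l : Fin (m + 1)) :
    ∑ i, faceMinor a τ i *
      (Fin.cons 1 (fun k => inner ℝ (a k) (τ i)) : Fin (m + 1) → ℝ) l = 0 := by
  let U : Fin (m + 1) → Fin (m + 2) → ℝ := fun l i =>
    (Fin.cons 1 (fun k => inner ℝ (a k) (τ i)) : Fin (m + 1) → ℝ) l
  let B : Matrix (Fin (m + 2)) (Fin (m + 2)) ℝ := Matrix.of (Fin.cons (U l) U)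
  have h1 : B.det = 0 :=
    Matrix.det_zero_of_row_eq (Fin.succ_ne_zero l).symm (by funext i; simp [B])
  rw [Matrix.det_succ_row_zero] at h1
  rw [← h1]
  refine Finset.sum_congr rfl fun i _ => ?_
  have h2 : B.submatrix Fin.succ i.succAbove = homogeneousMatrix a (face τ i) := by
    ext k j
    simp [B, U, homogeneousMatrix, face]
  rw [h2, faceMinor]
  simp only [B, Matrix.of_apply, Fin.cons_zero, U]
  ring

theorem sum_faceMinor (a : Fin m → Space) (τ : Fin (m + 2) → Space) :
    ∑ i, faceMinor a τ i = 0 := by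
  simpa using sum_faceMinor_mul a τ 0

theorem inner_sum_faceMinor (a : Fin m → Space) (τ : Fin (m + 2) → Space) (l : Fin m) :
    inner ℝ (a l) (∑ i, faceMinor a τ i • τ i) = 0 := by
  have h := sum_faceMinor_mul a τ l.succ
  simpa [inner_sum, real_inner_smul_right] using h

/-- Laplace expansion along the row of `h`; its index 1 gives the minus sign. -/
theorem det_homogeneousMatrix_cons (h : Space) (a : Fin m → Space) (τ : Fin (m + 2) → Space) :
    (homogeneousMatrix (Fin.cons h a : Fin (m + 1) → Space) τ).det =
      -inner ℝ h (∑ i, faceMinor a τ i • τ i) := by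
  rw [Matrix.det_succ_row _ 1, inner_sum, ← Finset.sum_neg_distrib]
  refine Finset.sum_congr rfl fun i _ => ?_
  have h2 : (homogeneousMatrix (Fin.cons h a : Fin (m + 1) → Space) τ).submatrix
      (Fin.succAbove 1) i.succAbove = homogeneousMatrix a (face τ i) := by
    ext k j
    refine Fin.cases ?_ (fun k => ?_) k <;> simp [homogeneousMatrix, face]
  have h3 : homogeneousMatrix (Fin.cons h a : Fin (m + 1) → Space) τ 1 i = inner ℝ h (τ i) := by
    rw [← Fin.succ_zero_eq_one]
    simp [homogeneousMatrix]
  rw [h2, h3, faceMinor, real_inner_smul_right, Fin.val_one, pow_add]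
  ring

theorem sign_faceMinor (a : Fin m → Space) (τ : Fin (m + 2) → Space) (i : Fin (m + 2)) :
    ((SignType.sign (faceMinor a τ i) : SignType) : ℤ) = (-1) ^ (i : ℕ) *
      ((SignType.sign (homogeneousMatrix a (face τ i)).det : SignType) : ℤ) := by
  rw [faceMinor]
  rcases neg_one_pow_eq_or ℝ (i : ℕ) with h | h
  · have h' : (-1 : ℤ) ^ (i : ℕ) = 1 := by exact_mod_cast h
    rw [h, h', one_mul, one_mul]
  · have h' : (-1 : ℤ) ^ (i : ℕ) = -1 := by exact_mod_cast h
    rw [h, h', sign_mul, signType_coe_mul]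
    simp

/-- The fibre over `x` meets no face of `τ` of codimension two. -/
def FibreGeneric (a : Fin m → Space) (x : Fin m → ℝ) (τ : Fin (m + 2) → Space) : Prop :=
  ∀ (i : Fin (m + 2)) (j : Fin (m + 1)) (w : Fin (m + 2) → ℝ), w i = 0 → w (i.succAbove j) = 0 →
    ∑ k, w k = 1 → ¬ ∀ l, inner ℝ (a l) (∑ k, w k • τ k) = x l

open Classical in
/-- The slice of the boundary by a half space of the fibre is the slice by its hyperplane. -/
theorem sum_crossSign_face {a : Fin m → Space} {x : Fin m → ℝ} {τ : Fin (m + 2) → Space}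
    (hx : FibreGeneric a x τ) {h : Space} {r : ℝ}
    (hr : ∀ i, r ≠ inner ℝ h (crossPoint a x (face τ i))) :
    ∑ i : Fin (m + 2), (-1) ^ (i : ℕ) * crossSign a x {y | inner ℝ h y < r} (face τ i) =
      -crossSign (Fin.cons h a : Fin (m + 1) → Space) (Fin.cons r x : Fin (m + 1) → ℝ)
        Set.univ τ := by
  set n := faceMinor a τ with hn
  set D : ℝ := inner ℝ h (∑ i, n i • τ i) with hD
  have hdet : (homogeneousMatrix (Fin.cons h a : Fin (m + 1) → Space) τ).det = -D :=
    det_homogeneousMatrix_cons h a τ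
  have hterm : ∀ i : Fin (m + 2), (-1) ^ (i : ℕ) * crossSign a x {y | inner ℝ h y < r} (face τ i) =
      if (∀ j, 0 < crossWeights a x (face τ i) j) ∧ inner ℝ h (crossPoint a x (face τ i)) < r then
        ((SignType.sign (n i) : SignType) : ℤ) else 0 := by
    intro i
    rw [hn, sign_faceMinor, crossSign, mul_ite, mul_zero]
    rfl
  simp only [hterm]
  by_cases h0 : n = 0
  · have hD0 : D = 0 := by simp [hD, h0]
    rw [crossSign, hdet, hD0]
    simp [h0]
  have hdetn : ∀ i, n i ≠ 0 → (homogeneousMatrix a (face τ i)).det ≠ 0 := fun i hi h1 =>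
    hi (by rw [hn, faceMinor, h1, mul_zero])
  obtain ⟨i0, hi0⟩ : ∃ i, n i ≠ 0 := by
    by_contra! h
    exact h0 (funext h)
  -- The barycentric coordinates, in `τ`, of the point where the fibre meets the plane of a
  -- transverse face. The points with coordinates `w + t * n` lie on the fibre, since `n` is in the
  -- kernel of the homogeneous coordinates.
  set w : Fin (m + 2) → ℝ := i0.insertNth 0 (crossWeights a x (face τ i0)) with hw
  have hw1 : ∑ k, w k = 1 := by
    rw [Fin.sum_univ_succAbove _ i0]
    simp [hw, sum_crossWeights (hdetn i0 hi0)]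
  have hwp : ∑ k, w k • τ k = crossPoint a x (face τ i0) := by
    rw [Fin.sum_univ_succAbove _ i0]
    simp [hw, crossPoint, face]
  have hwl : ∀ l, inner ℝ (a l) (∑ k, w k • τ k) = x l := fun l => by
    rw [hwp, inner_crossPoint (hdetn i0 hi0)]
  have hsum : ∀ t, ∑ k, (w k + t * n k) = 1 := fun t => by
    rw [Finset.sum_add_distrib, ← Finset.mul_sum, hw1, hn, sum_faceMinor, mul_zero, add_zero]
  have hpt : ∀ t, ∑ k, (w k + t * n k) • τ k = ∑ k, w k • τ k + t • ∑ k, n k • τ k := fun t => by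
    simp only [add_smul, Finset.sum_add_distrib, mul_smul, Finset.smul_sum]
  have hl : ∀ t l, inner ℝ (a l) (∑ k, (w k + t * n k) • τ k) = x l := fun t l => by
    rw [hpt, inner_add_right, hwl, real_inner_smul_right, hn, inner_sum_faceMinor, mul_zero,
      add_zero]
  -- The line reaches the plane of the face `i` at the parameter `-w i / n i`.
  have hzero : ∀ i, n i ≠ 0 → w i + -w i / n i * n i = 0 := fun i hi => by
    field_simp
    ring
  have hface : ∀ i, n i ≠ 0 →
      crossWeights a x (face τ i) = fun j => w (i.succAbove j) + -w i / n i * n (i.succAbove j) := by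
    intro i hi
    refine crossWeights_eq (hdetn i hi) ?_ fun l => ?_
    · have := hsum (-w i / n i)
      rwa [Fin.sum_univ_succAbove _ i, hzero i hi, zero_add] at this
    · have := hl (-w i / n i) l
      rwa [Fin.sum_univ_succAbove _ i, hzero i hi, zero_smul, zero_add] at this
  have hpoint : ∀ i, n i ≠ 0 → inner ℝ h (crossPoint a x (face τ i)) =
      inner ℝ h (∑ k, w k • τ k) + -w i / n i * D := by
    intro i hi
    have h1 : crossPoint a x (face τ i) = ∑ k, (w k + -w i / n i * n k) • τ k := by
      rw [crossPoint, hface i hi, Fin.sum_univ_succAbove _ i, hzero i hi, zero_smul, zero_add]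
      rfl
    rw [h1, hpt, inner_add_right, real_inner_smul_right]
  -- Equal parameters would put a point of the fibre in the span of a face of codimension two.
  have hgen : ∀ i j, i ≠ j → n i ≠ 0 → n j ≠ 0 → -w i / n i ≠ -w j / n j := by
    intro i j hij hi hj he
    obtain ⟨j', rfl⟩ := Fin.exists_succAbove_eq hij.symm
    refine hx i j' (fun k => w k + -w i / n i * n k) (hzero i hi) ?_ (hsum _) (hl _)
    rw [he]
    exact hzero _ hj
  have hmain := sum_sign_endpoints (b := inner ℝ h (∑ k, w k • τ k)) (D := D) (r := r)
    (sum_faceMinor a τ) h0 hgen fun i hi => hpoint i hi ▸ hr i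
  have hlhs : ∀ i, (if (∀ j, 0 < crossWeights a x (face τ i) j) ∧
      inner ℝ h (crossPoint a x (face τ i)) < r then
        ((SignType.sign (n i) : SignType) : ℤ) else 0) =
      if (∀ j, j ≠ i → 0 < w j + -w i / n i * n j) ∧
        inner ℝ h (∑ k, w k • τ k) + -w i / n i * D < r then
        ((SignType.sign (n i) : SignType) : ℤ) else 0 := by
    intro i
    by_cases hi : n i = 0
    · simp [hi]
    · rw [hpoint i hi, hface i hi]
      refine if_congr (and_congr_left fun _ => ?_) rfl rfl
      constructor
      · intro hpos j hj
        obtain ⟨j', rfl⟩ := Fin.exists_succAbove_eq hj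
        exact hpos j'
      · exact fun hpos j => hpos _ (Fin.succAbove_ne i j)
  refine Eq.trans ?_ (hmain.trans ?_)
  · refine Finset.sum_congr rfl fun i _ => (hlhs i).trans ?_
    congr
  rw [crossSign, hdet]
  by_cases hD0 : D = 0
  · simp [hD0]
  -- The height is affine in `t` with slope `D`, so it equals `r` at this parameter.
  have hcw : crossWeights (Fin.cons h a : Fin (m + 1) → Space) (Fin.cons r x : Fin (m + 1) → ℝ) τ =
      fun j => w j + (r - inner ℝ h (∑ k, w k • τ k)) / D * n j := by
    refine crossWeights_eq (by rw [hdet]; exact neg_ne_zero.mpr hD0) (hsum _) fun l => ?_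
    refine Fin.cases ?_ (fun l => ?_) l
    · rw [Fin.cons_zero, Fin.cons_zero, hpt, inner_add_right, real_inner_smul_right, ← hD,
        div_mul_cancel₀ _ hD0]
      ring
    · rw [Fin.cons_succ, Fin.cons_succ, hl]
  rw [hcw, Left.sign_neg]
  simp only [Set.mem_univ, and_true]
  split_ifs
  · rcases SignType.sign D with _ | _ | _ <;> rfl
  · rfl

theorem affineSpan_range_ne_top (p : Fin m → Fin m → ℝ) :
    affineSpan ℝ (Set.range p) ≠ ⊤ := by
  intro h
  rcases m with _ | m
  · have : (Set.range p) = ∅ := Set.range_eq_empty p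
    rw [this, AffineSubspace.span_empty] at h
    exact AffineSubspace.bot_ne_top ℝ _ _ h
  · have h1 := finrank_vectorSpan_range_le ℝ p (n := m) (by simp)
    rw [← direction_affineSpan, h, AffineSubspace.direction_top, finrank_top] at h1
    simp at h1

/-- A face of codimension two has `m` vertices, whose images span a proper affine subspace of `ℝᵐ`,
a null set. -/
theorem ae_fibreGeneric (a : Fin m → Space) (τ : Fin (m + 2) → Space) :
    ∀ᵐ x, FibreGeneric a x τ := by
  unfold FibreGeneric
  rw [ae_all_iff]
  intro i
  rw [ae_all_iff]
  intro j
  let p : Fin m → Fin m → ℝ := fun k l => inner ℝ (a l) (τ (i.succAbove (j.succAbove k)))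
  filter_upwards [measure_eq_zero_iff_ae_notMem.mp
    (Measure.addHaar_affineSubspace volume _ (affineSpan_range_ne_top p))] with x hx w hi hj hs hl
  rw [Fin.sum_univ_succAbove _ i, hi, zero_add, Fin.sum_univ_succAbove _ j, hj, zero_add] at hs
  rw [Fin.sum_univ_succAbove _ i, hi, zero_smul, zero_add, Fin.sum_univ_succAbove _ j, hj,
    zero_smul, zero_add] at hl
  refine hx ?_
  have : x = ∑ k, w (i.succAbove (j.succAbove k)) • p k := by
    funext l
    rw [← hl l, inner_sum]
    simp [p, real_inner_smul_right]
  rw [this, ← Finset.affineCombination_eq_linear_combination _ _ _ hs]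
  exact affineCombination_mem_affineSpan hs _

theorem crossing_simplexBoundary {G : Type*} [AddCommGroup G] {a : Fin m → Space}
    {x : Fin m → ℝ} {c : SimplexChain G (m + 2)}
    (hx : ∀ τ ∈ c.support, FibreGeneric a x τ) {h : Space} {r : ℝ}
    (hr : ∀ τ ∈ c.support, ∀ i, r ≠ inner ℝ h (crossPoint a x (face τ i))) :
    crossing a x {y | inner ℝ h y < r} (simplexBoundary G (m + 1) c) =
      -crossing (Fin.cons h a : Fin (m + 1) → Space) (Fin.cons r x : Fin (m + 1) → ℝ)
        Set.univ c := by
  rw [crossing_eq_sum _ _ _ c, ← Finset.sum_neg_distrib]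
  have hc : c = ∑ τ ∈ c.support, Finsupp.single τ (c τ) := (Finsupp.sum_single c).symm
  conv_lhs => rw [hc, map_sum, map_sum]
  refine Finset.sum_congr rfl fun τ hτ => ?_
  rw [simplexBoundary_single, map_sum, ← neg_smul, ← sum_crossSign_face (hx τ hτ) (hr τ hτ),
    Finset.sum_smul]
  refine Finset.sum_congr rfl fun i _ => ?_
  rw [map_zsmul, crossing_single, smul_smul]
  rfl

end

/-! ### Averaging over linear maps -/

section

variable {m : ℕ}

theorem continuous_frameMatrix (e : Fin m → Space) :
    Continuous fun a : Fin m → Space => frameMatrix a e :=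
  continuous_matrix fun l j => by
    simp only [frameMatrix, Matrix.of_apply]
    fun_prop

theorem continuous_abs_det_frameMatrix (e : Fin m → Space) :
    Continuous fun a : Fin m → Space => |(frameMatrix a e).det| :=
  (continuous_frameMatrix e).matrix_det.abs

theorem measurable_ofReal_abs_det_frameMatrix (e : Fin m → Space) :
    Measurable fun a : Fin m → Space => ENNReal.ofReal |(frameMatrix a e).det| :=
  (continuous_abs_det_frameMatrix e).measurable.ennreal_ofReal

/-- The entries are at most one in modulus by Cauchy–Schwarz, and the determinant has `m!` terms. -/
theorem abs_det_frameMatrix_le {e : Fin m → Space} (he : Orthonormal ℝ e) {a : Fin m → Space}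
    (ha : a ∈ Metric.ball (0 : Fin m → Space) 1) :
    ENNReal.ofReal |(frameMatrix a e).det| ≤ (m.factorial : ℝ≥0∞) := by
  have h1 : ∀ l j, AbsoluteValue.abs (frameMatrix a e l j) ≤ 1 := by
    intro l j
    rw [AbsoluteValue.abs_apply]
    change |inner ℝ (a l) (e j)| ≤ 1
    refine (abs_real_inner_le_norm (a l) (e j)).trans ?_
    rw [he.1 j, mul_one]
    exact (norm_le_pi_norm a l).trans (by simpa using ha : ‖a‖ < 1).le
  have h2 := Matrix.det_le (abv := AbsoluteValue.abs) h1
  rw [AbsoluteValue.abs_apply] at h2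
  simp only [Fintype.card_fin, one_pow, nsmul_eq_mul, mul_one] at h2
  rw [← ENNReal.ofReal_natCast]
  exact ENNReal.ofReal_le_ofReal h2

/-- Extend both families to orthonormal bases of the space and map one basis to the other. -/
theorem exists_linearIsometryEquiv_of_orthonormal {e e' : Fin m → Space} (he : Orthonormal ℝ e)
    (he' : Orthonormal ℝ e') : ∃ L : Space ≃ₗᵢ[ℝ] Space, ∀ j, L (e j) = e' j := by
  have hm : m ≤ 3 := by
    have := he.linearIndependent.fintype_card_le_finrank
    simpa using this
  have h : ∀ v : Fin m → Space, Orthonormal ℝ v →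
      ∃ b : OrthonormalBasis (Fin 3) ℝ Space, ∀ j, b (Fin.castLE hm j) = v j := by
    intro v hv
    let f : Fin 3 → Space := fun i => if h : (i : ℕ) < m then v ⟨i, h⟩ else 0
    let s : Set (Fin 3) := {i | (i : ℕ) < m}
    have hf : Orthonormal ℝ (s.domRestrict f) := by
      have : s.domRestrict f = v ∘ fun i : s => (⟨(i : Fin 3), i.2⟩ : Fin m) := by
        funext i
        exact dif_pos i.2
      rw [this]
      refine hv.comp _ fun i j hij => ?_
      exact Subtype.ext (Fin.ext (congrArg (fun k : Fin m => (k : ℕ)) hij))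
    obtain ⟨b, hb⟩ := hf.exists_orthonormalBasis_extension_of_card_eq (by simp)
    refine ⟨b, fun j => ?_⟩
    rw [hb (Fin.castLE hm j) j.2]
    exact dif_pos j.2
  obtain ⟨b, hb⟩ := h e he
  obtain ⟨b', hb'⟩ := h e' he'
  refine ⟨b.equiv b' (Equiv.refl _), fun j => ?_⟩
  rw [← hb, ← hb', OrthonormalBasis.equiv_apply_basis]
  rfl

/-- Rotating every row of `a` preserves the measure and the ball, and takes one frame to the other.
-/
theorem lintegral_frameMatrix_eq {e e' : Fin m → Space} (he : Orthonormal ℝ e)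
    (he' : Orthonormal ℝ e') :
    ∫⁻ a in Metric.ball (0 : Fin m → Space) 1, ENNReal.ofReal |(frameMatrix a e).det| =
      ∫⁻ a in Metric.ball (0 : Fin m → Space) 1, ENNReal.ofReal |(frameMatrix a e').det| := by
  obtain ⟨L, hL⟩ := exists_linearIsometryEquiv_of_orthonormal he he'
  have hmp : MeasurePreserving (fun (a : Fin m → Space) l => L (a l)) volume volume :=
    volume_preserving_pi fun _ => L.measurePreserving
  have hb : (fun (a : Fin m → Space) l => L (a l)) ⁻¹' Metric.ball 0 1 = Metric.ball 0 1 := by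
    ext a
    simp [pi_norm_lt_iff]
  rw [← hmp.setLIntegral_comp_preimage Metric.isOpen_ball.measurableSet
    (measurable_ofReal_abs_det_frameMatrix e'), hb]
  have : ∀ a : Fin m → Space, frameMatrix (fun l => L (a l)) e' = frameMatrix a e := by
    intro a
    ext l j
    simp only [frameMatrix, Matrix.of_apply, ← hL, LinearIsometryEquiv.inner_map_map]
  simp only [this]

/-- The integrand is continuous, and positive at the rows `e / 2`, which lie in the ball. -/
theorem lintegral_frameMatrix_ne_zero {e : Fin m → Space} (he : Orthonormal ℝ e) :
    ∫⁻ a in Metric.ball (0 : Fin m → Space) 1, ENNReal.ofReal |(frameMatrix a e).det| ≠ 0 := by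
  intro h
  rw [lintegral_eq_zero_iff (measurable_ofReal_abs_det_frameMatrix e), EventuallyEq,
    ae_restrict_iff' Metric.isOpen_ball.measurableSet] at h
  have hopen : IsOpen (Metric.ball (0 : Fin m → Space) 1 ∩
      {a | (0 : ℝ) < |(frameMatrix a e).det|}) :=
    Metric.isOpen_ball.inter (isOpen_lt continuous_const (continuous_abs_det_frameMatrix e))
  refine (hopen.measure_pos volume ⟨fun l => (1 / 2 : ℝ) • e l, ?_, ?_⟩).ne' ?_
  · rw [mem_ball_zero_iff]
    refine (pi_norm_lt_iff one_pos).mpr fun l => ?_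
    rw [norm_smul, he.1 l]
    norm_num
  · have : frameMatrix (fun l => (1 / 2 : ℝ) • e l) e = (1 / 2 : ℝ) • (1 : Matrix _ _ ℝ) := by
      ext l j
      simp [frameMatrix, real_inner_smul_left, orthonormal_iff_ite.mp he, Matrix.one_apply]
    rw [Set.mem_ofPred_eq, this, Matrix.det_smul, Matrix.det_one]
    positivity
  · rw [measure_eq_zero_iff_ae_notMem]
    filter_upwards [h] with a ha hmem
    have h1 := ha hmem.1
    rw [Pi.zero_apply, ENNReal.ofReal_eq_zero] at h1
    exact absurd hmem.2 (not_lt.mpr h1)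

/-- The mean area factor of the linear maps with rows in the unit ball does not depend on the
plane. -/
theorem exists_meanAreaFactor (m : ℕ) : ∃ κ : ℝ≥0∞, κ ≠ 0 ∧ κ ≠ ∞ ∧
    ∀ e : Fin m → Space, Orthonormal ℝ e →
      ∫⁻ a in Metric.ball (0 : Fin m → Space) 1, ENNReal.ofReal |(frameMatrix a e).det| = κ := by
  by_cases h : ∃ e : Fin m → Space, Orthonormal ℝ e
  · obtain ⟨e, he⟩ := h
    refine ⟨_, lintegral_frameMatrix_ne_zero he, ?_, fun e' he' => lintegral_frameMatrix_eq he' he⟩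
    refine ((setLIntegral_mono' Metric.isOpen_ball.measurableSet
      fun a ha => abs_det_frameMatrix_le he ha).trans_lt ?_).ne
    rw [setLIntegral_const]
    exact ENNReal.mul_lt_top (by simp) measure_ball_lt_top
  -- Without orthonormal `m`-frames the condition on κ is empty, and any positive finite value will
  -- do.
  · exact ⟨1, one_ne_zero, ENNReal.one_ne_top, fun e he => absurd ⟨e, he⟩ h⟩

end

/-! ### Measurability of intersection numbers -/

section

variable {G : Type*} [NormedAddCommGroup G] {m : ℕ} {P : Type*} [MeasurableSpace P]
  {A : P → Fin m → Space} {X : P → Fin m → ℝ}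

theorem continuous_homogeneousMatrix (σ : Fin (m + 1) → Space) :
    Continuous fun a : Fin m → Space => homogeneousMatrix a σ := by
  refine continuous_matrix fun i j => ?_
  refine Fin.cases ?_ (fun l => ?_) i
  · simpa [homogeneousMatrix] using continuous_const
  · simp only [homogeneousMatrix, Matrix.of_apply, Fin.cons_succ]
    fun_prop

theorem measurable_crossWeights (hA : Measurable A) (hX : Measurable X) (σ : Fin (m + 1) → Space)
    (j : Fin (m + 1)) : Measurable fun p => crossWeights (A p) (X p) σ j := by
  have hc := continuous_homogeneousMatrix σ
  have h1 : ∀ i, Measurable fun p => (Fin.cons 1 (X p) : Fin (m + 1) → ℝ) i := by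
    intro i
    refine Fin.cases ?_ (fun l => ?_) i
    · simp
    · simp only [Fin.cons_succ]
      exact (measurable_pi_apply l).comp hX
  have h2 : ∀ i, Measurable fun p => (homogeneousMatrix (A p) σ)⁻¹ j i := by
    intro i
    simp only [Matrix.inv_def, Ring.inverse_eq_inv', Matrix.smul_apply, smul_eq_mul]
    refine Measurable.mul ?_ ?_
    · exact (hc.matrix_det.measurable.comp hA).inv
    · exact ((hc.matrix_adjugate.matrix_elem j i).measurable).comp hA
  simp only [crossWeights, Matrix.mulVec, dotProduct]
  exact Finset.measurable_fun_sum _ fun i _ => (h2 i).mul (h1 i)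

theorem measurable_crossPoint (hA : Measurable A) (hX : Measurable X)
    (σ : Fin (m + 1) → Space) : Measurable fun p => crossPoint (A p) (X p) σ := by
  unfold crossPoint
  exact Finset.measurable_fun_sum _ fun j _ => (measurable_crossWeights hA hX σ j).smul_const _

/-- Intersection numbers depend on the parameter only through finitely many integer signs, and every
function of these is measurable; again `G` needs no measurable structure. -/
theorem measurable_enorm_crossing (hA : Measurable A) (hX : Measurable X) {U : P → Set Space}
    (hU : ∀ f : P → Space, Measurable f → MeasurableSet {p | f p ∈ U p})
    (c : SimplexChain G (m + 1)) : Measurable fun p => ‖crossing (A p) (X p) (U p) c‖ₑ := by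
  classical
  have h1 : ∀ σ : Fin (m + 1) → Space, Measurable fun p => crossSign (A p) (X p) (U p) σ := by
    intro σ
    unfold crossSign
    have hw : MeasurableSet {p | ∀ j, 0 < crossWeights (A p) (X p) σ j} := by
      rw [Set.ofPred_forall]
      exact MeasurableSet.iInter fun j =>
        measurableSet_lt measurable_const (measurable_crossWeights hA hX σ j)
    refine Measurable.ite (hw.inter (hU _ (measurable_crossPoint hA hX σ))) ?_ measurable_const
    · have hd : Measurable fun p => (homogeneousMatrix (A p) σ).det :=
        (continuous_homogeneousMatrix σ).matrix_det.measurable.comp hA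
      simp only [sign_apply]
      have : ∀ p, (((if 0 < (homogeneousMatrix (A p) σ).det then 1 else
          if (homogeneousMatrix (A p) σ).det < 0 then -1 else 0 : SignType) : SignType) : ℤ) =
          if 0 < (homogeneousMatrix (A p) σ).det then 1 else
          if (homogeneousMatrix (A p) σ).det < 0 then -1 else 0 := by
        intro p
        split_ifs <;> rfl
      simp only [this]
      exact Measurable.ite (measurableSet_lt measurable_const hd) measurable_const
        (Measurable.ite (measurableSet_lt hd measurable_const) measurable_const measurable_const)
  let F : (c.support → ℤ) → ℝ≥0∞ := fun s => ‖∑ σ : c.support, s σ • c σ‖ₑ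
  have h2 : (fun p => ‖crossing (A p) (X p) (U p) c‖ₑ) =
      F ∘ fun p (σ : c.support) => crossSign (A p) (X p) (U p) σ := by
    funext p
    simp only [F, Function.comp]
    rw [crossing_eq_sum, ← Finset.sum_coe_sort]
  rw [h2]
  exact (Measurable.of_discrete (f := F)).comp (measurable_pi_lambda _ fun σ => h1 _)

end

/-! ### The mass of the fibres -/

section

variable {G : Type*} [NormedAddCommGroup G] {m : ℕ}

open Classical in
/-- The modulus of the multiplicity of `c` at the intersection of the fibre over `x` with the plane
of `ρ`, if the two are transverse. -/
def fibreTerm (c : SimplexChain G (m + 1)) (a : Fin m → Space) (x : Fin m → ℝ)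
    (ρ : Fin (m + 1) → Space) : ℝ≥0∞ :=
  if (homogeneousMatrix a ρ).det = 0 then 0 else ‖multiplicity ρ (crossPoint a x ρ) c‖ₑ

theorem measurable_fibreTerm (c : SimplexChain G (m + 1)) (a : Fin m → Space)
    (ρ : Fin (m + 1) → Space) : Measurable fun x => fibreTerm c a x ρ := by
  unfold fibreTerm
  split_ifs
  · exact measurable_const
  · exact (measurable_enorm_multiplicity ρ c).comp (continuous_crossPoint a ρ).measurable

open Classical in
theorem enorm_crossing_term (c : SimplexChain G (m + 1)) (a : Fin m → Space) (x : Fin m → ℝ)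
    (U : Set Space) (ρ : Fin (m + 1) → Space) :
    ‖if crossPoint a x ρ ∈ U then ((SignType.sign (homogeneousMatrix a ρ).det : SignType) : ℤ) •
        multiplicity ρ (crossPoint a x ρ) c else 0‖ₑ =
      if crossPoint a x ρ ∈ U then fibreTerm c a x ρ else 0 := by
  unfold fibreTerm
  split_ifs with h1 h2
  · simp [h2]
  · rcases lt_or_gt_of_ne h2 with h | h
    · simp [sign_neg h]
    · simp [sign_pos h]
  · exact enorm_zero

open Classical in
theorem enorm_crossing_le {c : SimplexChain G (m + 1)} {R : Finset (Fin (m + 1) → Space)}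
    (hR : RepresentsPlanes c R) (a : Fin m → Space) (x : Fin m → ℝ) (U : Set Space) :
    ‖crossing a x U c‖ₑ ≤ ∑ ρ ∈ R, if crossPoint a x ρ ∈ U then fibreTerm c a x ρ else 0 := by
  rw [crossing_eq_sum_multiplicity hR]
  refine (enorm_sum_le _ _).trans (Finset.sum_le_sum fun ρ _ => ?_)
  rw [enorm_crossing_term]

open Classical in
/-- If a transverse plane meets the fibre in `U` for at most one `ρ`, then no cancellation occurs. -/
theorem enorm_crossing_eq {c : SimplexChain G (m + 1)} {R : Finset (Fin (m + 1) → Space)}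
    (hR : RepresentsPlanes c R) {a : Fin m → Space} {x : Fin m → ℝ} {U : Set Space}
    (hU : ∀ ρ ∈ R, ∀ ρ' ∈ R, (homogeneousMatrix a ρ).det ≠ 0 → (homogeneousMatrix a ρ').det ≠ 0 →
      crossPoint a x ρ ∈ U → crossPoint a x ρ' ∈ U → ρ = ρ') :
    ‖crossing a x U c‖ₑ = ∑ ρ ∈ R, if crossPoint a x ρ ∈ U then fibreTerm c a x ρ else 0 := by
  rw [crossing_eq_sum_multiplicity hR]
  by_cases h : ∃ ρ ∈ R, (homogeneousMatrix a ρ).det ≠ 0 ∧ crossPoint a x ρ ∈ U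
  · obtain ⟨ρ, hρ, hd, hρU⟩ := h
    rw [Finset.sum_eq_single_of_mem ρ hρ, Finset.sum_eq_single_of_mem ρ hρ, enorm_crossing_term]
    · intro ρ' hρ' hne
      by_cases h0 : (homogeneousMatrix a ρ').det = 0
      · simp [fibreTerm, h0]
      · exact if_neg fun h1 => hne (hU ρ' hρ' ρ hρ h0 hd h1 hρU)
    · intro ρ' hρ' hne
      by_cases h0 : (homogeneousMatrix a ρ').det = 0
      · simp [h0]
      · exact if_neg fun h1 => hne (hU ρ' hρ' ρ hρ h0 hd h1 hρU)
  · push Not at h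
    rw [Finset.sum_eq_zero, Finset.sum_eq_zero, enorm_zero]
    · intro ρ hρ
      by_cases h0 : (homogeneousMatrix a ρ).det = 0
      · simp [fibreTerm, h0]
      · exact if_neg (h ρ hρ h0)
    · intro ρ hρ
      by_cases h0 : (homogeneousMatrix a ρ).det = 0
      · simp [h0]
      · exact if_neg (h ρ hρ h0)

/-- The area formula on one plane; for nontransverse `a` both sides vanish. The frame is chosen
before `a`, so that the formula can be averaged. -/
theorem exists_lintegral_fibreTerm {ρ : Fin (m + 1) → Space} (hρ : AffineIndependent ℝ ρ) :
    ∃ e : Fin m → Space, Orthonormal ℝ e ∧ ∀ (c : SimplexChain G (m + 1)) (a : Fin m → Space),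
      ∫⁻ x, fibreTerm c a x ρ = ENNReal.ofReal |(frameMatrix a e).det| *
        ∫⁻ y in affineSpan ℝ (Set.range ρ), ‖multiplicity ρ y c‖ₑ ∂(μHE[m] : Measure Space) := by
  obtain ⟨e, he, hr⟩ := exists_orthonormal_range_planeMap hρ
  refine ⟨e, he, fun c a => ?_⟩
  unfold fibreTerm
  by_cases h : (homogeneousMatrix a ρ).det = 0
  · have h0 : (frameMatrix a e).det = 0 := by
      by_contra h0
      exact (det_homogeneousMatrix_ne_zero_iff hρ hr he a).mpr h0 h
    simp [h, h0]
  · simp only [if_neg h]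
    exact lintegral_crossPoint hρ hr he a h (measurable_enorm_multiplicity ρ c)

theorem lintegral_sum_fibreTerm_le {c : SimplexChain G (m + 1)}
    {R : Finset (Fin (m + 1) → Space)} (hR : RepresentsPlanes c R) {a : Fin m → Space}
    (ha : a ∈ Metric.ball (0 : Fin m → Space) 1) :
    ∫⁻ x, ∑ ρ ∈ R, fibreTerm c a x ρ ≤ m.factorial * simplexMass c := by
  rw [lintegral_finsetSum _ fun ρ _ => measurable_fibreTerm c a ρ, simplexMass_eq_sum hR,
    Finset.mul_sum]
  refine Finset.sum_le_sum fun ρ hρ => ?_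
  obtain ⟨e, he, h⟩ := exists_lintegral_fibreTerm (G := G) (hR.affineIndependent ρ hρ)
  rw [h]
  gcongr
  exact abs_det_frameMatrix_le he ha

/-- The Cauchy–Crofton formula: after averaging, the area factor of every plane is κ. -/
theorem lintegral_lintegral_sum_fibreTerm {κ : ℝ≥0∞}
    (hκ : ∀ e : Fin m → Space, Orthonormal ℝ e →
      ∫⁻ a in Metric.ball (0 : Fin m → Space) 1, ENNReal.ofReal |(frameMatrix a e).det| = κ)
    {c : SimplexChain G (m + 1)} {R : Finset (Fin (m + 1) → Space)} (hR : RepresentsPlanes c R) :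
    ∫⁻ a in Metric.ball (0 : Fin m → Space) 1, ∫⁻ x, ∑ ρ ∈ R, fibreTerm c a x ρ =
      κ * simplexMass c := by
  have h := fun ρ hρ => exists_lintegral_fibreTerm (G := G) (hR.affineIndependent ρ hρ)
  choose! e he h using h
  have h1 : ∀ a, ∫⁻ x, ∑ ρ ∈ R, fibreTerm c a x ρ = ∑ ρ ∈ R,
      ENNReal.ofReal |(frameMatrix a (e ρ)).det| * ∫⁻ y in affineSpan ℝ (Set.range ρ),
        ‖multiplicity ρ y c‖ₑ ∂(μHE[m] : Measure Space) := fun a => by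
    rw [lintegral_finsetSum _ fun ρ _ => measurable_fibreTerm c a ρ]
    exact Finset.sum_congr rfl fun ρ hρ => h ρ hρ c a
  simp only [h1]
  rw [lintegral_finsetSum _ fun ρ _ =>
    (measurable_ofReal_abs_det_frameMatrix (e ρ)).mul_const _, simplexMass_eq_sum hR,
    Finset.mul_sum]
  refine Finset.sum_congr rfl fun ρ hρ => ?_
  rw [lintegral_mul_const _ (measurable_ofReal_abs_det_frameMatrix (e ρ)), hκ _ (he ρ hρ)]

end

/-! ### The averaged variation of intersection numbers -/

section

/-- The slab of thickness `δ` above the plane `⟨h, y⟩ = r`. -/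
def slab (h : Space) (r δ : ℝ) : Set Space :=
  {y | r ≤ inner ℝ h y ∧ inner ℝ h y < r + δ}

variable {G : Type*} [NormedAddCommGroup G] {m : ℕ}

/-- The variation at scale `δ` of the intersection numbers with half spaces of the fibres, averaged
over the linear maps and the half spaces. -/
def averagedVariation (δ : ℝ) (c : SimplexChain G (m + 1)) : ℝ≥0∞ :=
  ∫⁻ a in Metric.ball (0 : Fin m → Space) 1, ∫⁻ x, ∫⁻ h in Metric.ball (0 : Space) 1,
    ∫⁻ r, ‖crossing a x (slab h r δ) c‖ₑ

theorem measurable_section {α β : Type*} [MeasurableSpace α] [MeasurableSpace β]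
    {f : α × β → ℝ≥0∞} (hf : Measurable f) (a : α) : Measurable fun b => f (a, b) :=
  hf.comp measurable_prodMk_left

theorem measurable_enorm_crossing_slab (δ : ℝ) (c : SimplexChain G (m + 1)) :
    Measurable fun p : (((Fin m → Space) × (Fin m → ℝ)) × Space) × ℝ =>
      ‖crossing p.1.1.1 p.1.1.2 (slab p.1.2 p.2 δ) c‖ₑ := by
  refine measurable_enorm_crossing (by fun_prop) (by fun_prop) (fun f hf => ?_) c
  have h1 : Measurable fun p : (((Fin m → Space) × (Fin m → ℝ)) × Space) × ℝ =>
      inner ℝ p.1.2 (f p) := Measurable.inner (by fun_prop) hf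
  exact (measurableSet_le (by fun_prop) h1).inter (measurableSet_lt h1 (by fun_prop))

theorem measurable_lintegral_crossing_slab (δ : ℝ) (c : SimplexChain G (m + 1)) :
    Measurable fun p : ((Fin m → Space) × (Fin m → ℝ)) × Space =>
      ∫⁻ r, ‖crossing p.1.1 p.1.2 (slab p.2 r δ) c‖ₑ :=
  (measurable_enorm_crossing_slab δ c).lintegral_prod_right'

theorem measurable_lintegral_lintegral_crossing_slab (δ : ℝ) (c : SimplexChain G (m + 1)) :
    Measurable fun p : (Fin m → Space) × (Fin m → ℝ) => ∫⁻ h in Metric.ball (0 : Space) 1,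
      ∫⁻ r, ‖crossing p.1 p.2 (slab h r δ) c‖ₑ :=
  (measurable_lintegral_crossing_slab δ c).lintegral_prod_right'

theorem measurable_lintegral_lintegral_lintegral_crossing_slab (δ : ℝ)
    (c : SimplexChain G (m + 1)) :
    Measurable fun a : Fin m → Space => ∫⁻ x, ∫⁻ h in Metric.ball (0 : Space) 1,
      ∫⁻ r, ‖crossing a x (slab h r δ) c‖ₑ :=
  (measurable_lintegral_lintegral_crossing_slab δ c).lintegral_prod_right'

theorem averagedVariation_add_le (δ : ℝ) (c d : SimplexChain G (m + 1)) :
    averagedVariation δ (c + d) ≤ averagedVariation δ c + averagedVariation δ d := by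
  unfold averagedVariation
  rw [← lintegral_add_left (measurable_lintegral_lintegral_lintegral_crossing_slab δ c)]
  refine lintegral_mono fun a => ?_
  have h1 : Measurable fun x => ∫⁻ h in Metric.ball (0 : Space) 1,
      ∫⁻ r, ‖crossing a x (slab h r δ) c‖ₑ :=
    measurable_section (measurable_lintegral_lintegral_crossing_slab δ c) a
  rw [← lintegral_add_left h1]
  refine lintegral_mono fun x => ?_
  have h2 : Measurable fun h => ∫⁻ r, ‖crossing a x (slab h r δ) c‖ₑ :=
    measurable_section (measurable_lintegral_crossing_slab δ c) (a, x)
  rw [← lintegral_add_left h2]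
  refine lintegral_mono fun h => ?_
  have h3 : Measurable fun r => ‖crossing a x (slab h r δ) c‖ₑ :=
    measurable_section (measurable_enorm_crossing_slab δ c) ((a, x), h)
  rw [← lintegral_add_left h3]
  refine lintegral_mono fun r => ?_
  rw [map_add]
  exact enorm_add_le _ _

theorem averagedVariation_neg (δ : ℝ) (c : SimplexChain G (m + 1)) :
    averagedVariation δ (-c) = averagedVariation δ c := by
  simp [averagedVariation]

open Classical in
-- The heights `r` whose slab contains a given point form an interval of length δ.
theorem lintegral_slab (c : SimplexChain G (m + 1)) (R : Finset (Fin (m + 1) → Space))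
    (a : Fin m → Space) (x : Fin m → ℝ) (h : Space) (δ : ℝ) :
    ∫⁻ r, ∑ ρ ∈ R, (if crossPoint a x ρ ∈ slab h r δ then fibreTerm c a x ρ else 0) =
      ENNReal.ofReal δ * ∑ ρ ∈ R, fibreTerm c a x ρ := by
  have h1 : ∀ ρ r, (if crossPoint a x ρ ∈ slab h r δ then fibreTerm c a x ρ else 0) =
      (Set.Ioc (inner ℝ h (crossPoint a x ρ) - δ) (inner ℝ h (crossPoint a x ρ))).indicator
        (fun _ => fibreTerm c a x ρ) r := by
    intro ρ r
    rw [Set.indicator_apply]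
    refine if_congr ⟨fun hy => ⟨by linarith [hy.2], hy.1⟩, fun hy => ⟨hy.2, ?_⟩⟩ rfl rfl
    linarith [hy.1]
  simp only [h1]
  rw [lintegral_finsetSum _ fun ρ _ => measurable_const.indicator measurableSet_Ioc,
    Finset.mul_sum]
  refine Finset.sum_congr rfl fun ρ _ => ?_
  rw [lintegral_indicator_const measurableSet_Ioc, Real.volume_Ioc, sub_sub_cancel, mul_comm]

theorem lintegral_crossing_slab_le {c : SimplexChain G (m + 1)}
    {R : Finset (Fin (m + 1) → Space)} (hR : RepresentsPlanes c R) (a : Fin m → Space)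
    (x : Fin m → ℝ) (h : Space) (δ : ℝ) :
    ∫⁻ r, ‖crossing a x (slab h r δ) c‖ₑ ≤ ENNReal.ofReal δ * ∑ ρ ∈ R, fibreTerm c a x ρ := by
  rw [← lintegral_slab]
  exact lintegral_mono fun r => enorm_crossing_le hR a x _

variable {κ : ℝ≥0∞}

/-- The averaged variation is controlled by the mass. -/
theorem averagedVariation_le
    (hκ : ∀ e : Fin m → Space, Orthonormal ℝ e →
      ∫⁻ a in Metric.ball (0 : Fin m → Space) 1, ENNReal.ofReal |(frameMatrix a e).det| = κ)
    (δ : ℝ) (c : SimplexChain G (m + 1)) :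
    averagedVariation δ c ≤
      ENNReal.ofReal δ * (volume (Metric.ball (0 : Space) 1) * κ) * simplexMass c := by
  obtain ⟨R, hR⟩ := exists_representsPlanes c
  have hβ : volume (Metric.ball (0 : Space) 1) ≠ ∞ := measure_ball_lt_top.ne
  have hδ : ENNReal.ofReal δ * volume (Metric.ball (0 : Space) 1) ≠ ∞ :=
    ENNReal.mul_ne_top ENNReal.ofReal_ne_top hβ
  calc averagedVariation δ c
      ≤ ∫⁻ a in Metric.ball (0 : Fin m → Space) 1, ∫⁻ x,
          ENNReal.ofReal δ * volume (Metric.ball (0 : Space) 1) *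
            ∑ ρ ∈ R, fibreTerm c a x ρ := by
        refine lintegral_mono fun a => lintegral_mono fun x => ?_
        refine (lintegral_mono fun h => lintegral_crossing_slab_le hR a x h δ).trans ?_
        rw [setLIntegral_const]
        exact le_of_eq (by ring)
    _ = ENNReal.ofReal δ * volume (Metric.ball (0 : Space) 1) * (κ * simplexMass c) := by
        rw [← lintegral_lintegral_sum_fibreTerm hκ hR, ← lintegral_const_mul' _ _ hδ]
        exact lintegral_congr fun a => lintegral_const_mul' _ _ hδ
    _ = _ := by ring

/-! ### Recovering the mass from thin slabs -/

theorem ae_inner_ne_zero {v : Space} (hv : v ≠ 0) : ∀ᵐ h : Space, inner ℝ h v ≠ (0 : ℝ) := by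
  have h1 : LinearMap.ker (innerₛₗ ℝ v : Space →ₗ[ℝ] ℝ) ≠ ⊤ := by
    intro h
    have : v ∈ LinearMap.ker (innerₛₗ ℝ v : Space →ₗ[ℝ] ℝ) := h ▸ Submodule.mem_top
    rw [LinearMap.mem_ker] at this
    exact hv (inner_self_eq_zero.mp this)
  filter_upwards [measure_eq_zero_iff_ae_notMem.mp
    (Measure.addHaar_submodule (volume : Measure Space) _ h1)] with h hh h0
  refine hh ?_
  rw [SetLike.mem_coe, LinearMap.mem_ker, innerₛₗ_apply_apply, real_inner_comm]
  exact h0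

/-- A common crossing point lies on both planes. By the area formula for the indicator of the second
plane, this happens only for a null set of `x`. -/
theorem ae_crossPoint_ne {ρ ρ' : Fin (m + 1) → Space} (hρ : AffineIndependent ℝ ρ)
    (hρ' : AffineIndependent ℝ ρ')
    (hne : affineSpan ℝ (Set.range ρ) ≠ affineSpan ℝ (Set.range ρ')) {a : Fin m → Space}
    (hd : (homogeneousMatrix a ρ).det ≠ 0) (hd' : (homogeneousMatrix a ρ').det ≠ 0) :
    ∀ᵐ x, crossPoint a x ρ ≠ crossPoint a x ρ' := by
  obtain ⟨e, he, hr⟩ := exists_orthonormal_range_planeMap hρ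
  have hm : MeasurableSet (affineSpan ℝ (Set.range ρ') : Set Space) :=
    (AffineSubspace.closed_of_finiteDimensional _).measurableSet
  have h1 := lintegral_crossPoint hρ hr he a hd
    (F := (affineSpan ℝ (Set.range ρ') : Set Space).indicator 1) (measurable_one.indicator hm)
  rw [lintegral_indicator_one hm, Measure.restrict_apply hm, Set.inter_comm,
    measure_affineSpan_inter hρ hρ' hne, mul_zero] at h1
  have h2 : Measurable fun x =>
      (affineSpan ℝ (Set.range ρ') : Set Space).indicator (1 : Space → ℝ≥0∞) (crossPoint a x ρ) :=
    (measurable_one.indicator hm).comp (continuous_crossPoint a ρ).measurable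
  rw [lintegral_eq_zero_iff h2] at h1
  filter_upwards [h1] with x hx he
  rw [he, Pi.zero_apply, Set.indicator_of_mem (crossPoint_mem_affineSpan hd')] at hx
  exact one_ne_zero hx

/-- A sequence of scales that tends to zero. -/
def scale (i : ℕ) : ℝ := 1 / ((i : ℝ) + 1)

theorem scale_pos (i : ℕ) : 0 < scale i := Nat.one_div_pos_of_nat

/-- Once the scale is below all gaps between the heights of the crossing points, a slab contains at
most one of them and `enorm_crossing_eq` excludes cancellation. -/
theorem eventually_lintegral_crossing_slab {c : SimplexChain G (m + 1)}
    {R : Finset (Fin (m + 1) → Space)} (hR : RepresentsPlanes c R) {a : Fin m → Space}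
    {x : Fin m → ℝ} {h : Space}
    (hsep : ∀ ρ ∈ R, ∀ ρ' ∈ R, ρ ≠ ρ' → (homogeneousMatrix a ρ).det ≠ 0 →
      (homogeneousMatrix a ρ').det ≠ 0 →
      inner ℝ h (crossPoint a x ρ - crossPoint a x ρ') ≠ (0 : ℝ)) :
    ∀ᶠ i in atTop, ∑ ρ ∈ R, fibreTerm c a x ρ =
      (ENNReal.ofReal (scale i))⁻¹ * ∫⁻ r, ‖crossing a x (slab h r (scale i)) c‖ₑ := by
  have hlim : Tendsto scale atTop (𝓝 0) := tendsto_one_div_add_atTop_nhds_zero_nat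
  have h1 : ∀ᶠ i in atTop, ∀ ρ ∈ R, ∀ ρ' ∈ R, ρ ≠ ρ' → (homogeneousMatrix a ρ).det ≠ 0 →
      (homogeneousMatrix a ρ').det ≠ 0 →
      scale i < |inner ℝ h (crossPoint a x ρ - crossPoint a x ρ')| := by
    rw [Finset.eventually_all]
    intro ρ hρ
    rw [Finset.eventually_all]
    intro ρ' hρ'
    by_cases hc : ρ ≠ ρ' ∧ (homogeneousMatrix a ρ).det ≠ 0 ∧ (homogeneousMatrix a ρ').det ≠ 0
    · filter_upwards [hlim.eventually_lt_const
        (abs_pos.mpr (hsep ρ hρ ρ' hρ' hc.1 hc.2.1 hc.2.2))] with i hi _ _ _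
      exact hi
    · exact Eventually.of_forall fun i h1 h2 h3 => absurd ⟨h1, h2, h3⟩ hc
  filter_upwards [h1] with i hi
  have h2 : ∀ r, ‖crossing a x (slab h r (scale i)) c‖ₑ = _ := fun r =>
    enorm_crossing_eq hR fun ρ hρ ρ' hρ' hd hd' hy hy' => by
      by_contra hne
      have h3 := hi ρ hρ ρ' hρ' hne hd hd'
      rw [inner_sub_right, lt_abs] at h3
      rcases h3 with h3 | h3
      · linarith [hy.1, hy.2, hy'.1, hy'.2]
      · linarith [hy.1, hy.2, hy'.1, hy'.2]
  simp only [h2]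
  rw [lintegral_slab, ← mul_assoc, ENNReal.inv_mul_cancel _ ENNReal.ofReal_ne_top, one_mul]
  exact (ENNReal.ofReal_pos.mpr (scale_pos i)).ne'

/-- A generic `x` separates the crossing points, and a generic `h` then separates their heights. -/
theorem ae_eventually_lintegral_crossing_slab {c : SimplexChain G (m + 1)}
    {R : Finset (Fin (m + 1) → Space)} (hR : RepresentsPlanes c R) (a : Fin m → Space) :
    ∀ᵐ x, ∀ᵐ h : Space, ∀ᶠ i in atTop, ∑ ρ ∈ R, fibreTerm c a x ρ =
      (ENNReal.ofReal (scale i))⁻¹ * ∫⁻ r, ‖crossing a x (slab h r (scale i)) c‖ₑ := by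
  have h1 : ∀ᵐ x, ∀ ρ ∈ R, ∀ ρ' ∈ R, ρ ≠ ρ' → (homogeneousMatrix a ρ).det ≠ 0 →
      (homogeneousMatrix a ρ').det ≠ 0 → crossPoint a x ρ ≠ crossPoint a x ρ' := by
    rw [Finset.eventually_all]
    intro ρ hρ
    rw [Finset.eventually_all]
    intro ρ' hρ'
    by_cases hc : ρ ≠ ρ' ∧ (homogeneousMatrix a ρ).det ≠ 0 ∧ (homogeneousMatrix a ρ').det ≠ 0
    · filter_upwards [ae_crossPoint_ne (hR.affineIndependent ρ hρ) (hR.affineIndependent ρ' hρ')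
        (fun h => hc.1 (hR.injOn ρ hρ ρ' hρ' h)) hc.2.1 hc.2.2] with x hx _ _ _
      exact hx
    · exact Eventually.of_forall fun i h1 h2 h3 => absurd ⟨h1, h2, h3⟩ hc
  filter_upwards [h1] with x hx
  have h2 : ∀ᵐ h : Space, ∀ ρ ∈ R, ∀ ρ' ∈ R, ρ ≠ ρ' → (homogeneousMatrix a ρ).det ≠ 0 →
      (homogeneousMatrix a ρ').det ≠ 0 →
      inner ℝ h (crossPoint a x ρ - crossPoint a x ρ') ≠ (0 : ℝ) := by
    rw [Finset.eventually_all]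
    intro ρ hρ
    rw [Finset.eventually_all]
    intro ρ' hρ'
    by_cases hc : ρ ≠ ρ' ∧ (homogeneousMatrix a ρ).det ≠ 0 ∧ (homogeneousMatrix a ρ').det ≠ 0
    · filter_upwards [ae_inner_ne_zero
        (sub_ne_zero.mpr (hx ρ hρ ρ' hρ' hc.1 hc.2.1 hc.2.2))] with h hh _ _ _
      exact hh
    · exact Eventually.of_forall fun i h1 h2 h3 => absurd ⟨h1, h2, h3⟩ hc
  filter_upwards [h2] with h hh
  exact eventually_lintegral_crossing_slab hR hh

/-- The mass is recovered from the averaged variations at small scales. -/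
theorem le_liminf_averagedVariation
    (hκ : ∀ e : Fin m → Space, Orthonormal ℝ e →
      ∫⁻ a in Metric.ball (0 : Fin m → Space) 1, ENNReal.ofReal |(frameMatrix a e).det| = κ)
    (c : SimplexChain G (m + 1)) :
    volume (Metric.ball (0 : Space) 1) * κ * simplexMass c ≤
      liminf (fun i => (ENNReal.ofReal (scale i))⁻¹ * averagedVariation (scale i) c) atTop := by
  obtain ⟨R, hR⟩ := exists_representsPlanes c
  have hβ : volume (Metric.ball (0 : Space) 1) ≠ ∞ := measure_ball_lt_top.ne
  have hi : ∀ i, (ENNReal.ofReal (scale i))⁻¹ ≠ ∞ := fun i =>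
    ENNReal.inv_ne_top.mpr (ENNReal.ofReal_pos.mpr (scale_pos i)).ne'
  calc volume (Metric.ball (0 : Space) 1) * κ * simplexMass c
      = ∫⁻ a in Metric.ball (0 : Fin m → Space) 1, ∫⁻ x, ∫⁻ _ in Metric.ball (0 : Space) 1,
          ∑ ρ ∈ R, fibreTerm c a x ρ := by
        rw [mul_assoc, ← lintegral_lintegral_sum_fibreTerm hκ hR, ← lintegral_const_mul' _ _ hβ]
        refine lintegral_congr fun a => ?_
        rw [← lintegral_const_mul' _ _ hβ]
        refine lintegral_congr fun x => ?_
        rw [setLIntegral_const, mul_comm]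
    _ ≤ ∫⁻ a in Metric.ball (0 : Fin m → Space) 1, liminf (fun i => (ENNReal.ofReal (scale i))⁻¹ *
          ∫⁻ x, ∫⁻ h in Metric.ball (0 : Space) 1,
            ∫⁻ r, ‖crossing a x (slab h r (scale i)) c‖ₑ) atTop := by
        refine lintegral_mono fun a => ?_
        have hx : ∀ᵐ x, ∫⁻ _ in Metric.ball (0 : Space) 1, ∑ ρ ∈ R, fibreTerm c a x ρ ≤
            liminf (fun i => (ENNReal.ofReal (scale i))⁻¹ * ∫⁻ h in Metric.ball (0 : Space) 1,
              ∫⁻ r, ‖crossing a x (slab h r (scale i)) c‖ₑ) atTop := by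
          filter_upwards [ae_eventually_lintegral_crossing_slab hR a] with x hx
          have hh : ∀ᵐ h ∂(volume.restrict (Metric.ball (0 : Space) 1)),
              ∑ ρ ∈ R, fibreTerm c a x ρ ≤ liminf (fun i => (ENNReal.ofReal (scale i))⁻¹ *
                ∫⁻ r, ‖crossing a x (slab h r (scale i)) c‖ₑ) atTop := by
            filter_upwards [ae_restrict_of_ae hx] with h hh
            exact le_liminf_of_le (by isBoundedDefault) (hh.mono fun i h => h.le)
          -- Fatou's lemma in `h`; below it is applied in `x` and then in `a`.
          refine (lintegral_mono_ae hh).trans ((lintegral_liminf_le fun i => ?_).trans_eq ?_)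
          · exact ((measurable_lintegral_crossing_slab (scale i) c).comp
              (measurable_prodMk_left (x := (a, x)))).const_mul _
          · exact liminf_congr (Eventually.of_forall fun i => lintegral_const_mul' _ _ (hi i))
        refine (lintegral_mono_ae hx).trans ((lintegral_liminf_le fun i => ?_).trans_eq ?_)
        · exact ((measurable_lintegral_lintegral_crossing_slab (scale i) c).comp
            measurable_prodMk_left).const_mul _
        · exact liminf_congr (Eventually.of_forall fun i => lintegral_const_mul' _ _ (hi i))
    _ ≤ _ := by
        refine (lintegral_liminf_le fun i => ?_).trans_eq ?_
        · exact (measurable_lintegral_lintegral_lintegral_crossing_slab (scale i) c).const_mul _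
        · exact liminf_congr (Eventually.of_forall fun i => lintegral_const_mul' _ _ (hi i))

/-! ### The averaged variation of boundaries -/

open Classical in
theorem crossSign_eq_ite (a : Fin m → Space) (x : Fin m → ℝ) (U : Set Space)
    (σ : Fin (m + 1) → Space) : crossSign a x U σ =
      if crossPoint a x σ ∈ U then crossSign a x Set.univ σ else 0 := by
  by_cases h : crossPoint a x σ ∈ U <;> simp [crossSign, h]

/-- A slab is a difference of nested half spaces, to each of which `crossing_simplexBoundary`
applies. -/
theorem crossing_slab (a : Fin m → Space) (x : Fin m → ℝ) (h : Space) (r : ℝ) {δ : ℝ}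
    (hδ : 0 ≤ δ) (c : SimplexChain G (m + 1)) :
    crossing a x (slab h r δ) c = crossing a x {y | inner ℝ h y < r + δ} c -
      crossing a x {y | inner ℝ h y < r} c := by
  have key : ∀ σ : Fin (m + 1) → Space, crossSign a x (slab h r δ) σ =
      crossSign a x {y | inner ℝ h y < r + δ} σ - crossSign a x {y | inner ℝ h y < r} σ := by
    intro σ
    rw [crossSign_eq_ite a x (slab h r δ), crossSign_eq_ite a x {y | inner ℝ h y < r + δ},
      crossSign_eq_ite a x {y | inner ℝ h y < r}]
    simp only [slab, Set.mem_ofPred_eq]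
    by_cases h1 : inner ℝ h (crossPoint a x σ) < r
    · have h2 : inner ℝ h (crossPoint a x σ) < r + δ := by linarith
      simp [h1, h2, not_le.mpr h1]
    · simp [h1, not_lt.mp h1]
  rw [crossing_eq_sum, crossing_eq_sum, crossing_eq_sum, ← Finset.sum_sub_distrib]
  exact Finset.sum_congr rfl fun σ _ => by rw [key, sub_smul]

/-- The modulus of the intersection number of `c` with the fibre over `(r, x)` of the linear map
with rows `h` and `a`. -/
def consCrossing (c : SimplexChain G (m + 2)) (a : Fin m → Space) (x : Fin m → ℝ) (h : Space)
    (r : ℝ) : ℝ≥0∞ :=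
  ‖crossing (Fin.cons h a : Fin (m + 1) → Space) (Fin.cons r x : Fin (m + 1) → ℝ) Set.univ c‖ₑ

theorem measurable_consCrossing (c : SimplexChain G (m + 2)) (a : Fin m → Space) :
    Measurable fun p : ((Fin m → ℝ) × Space) × ℝ => consCrossing c a p.1.1 p.1.2 p.2 := by
  refine measurable_enorm_crossing (U := fun _ => Set.univ) ?_ ?_ (fun f hf => ?_) c
  · refine measurable_pi_lambda _ fun i => ?_
    refine Fin.cases ?_ (fun l => ?_) i
    · simp only [Fin.cons_zero]
      fun_prop
    · simp only [Fin.cons_succ]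
      fun_prop
  · refine measurable_pi_lambda _ fun i => ?_
    refine Fin.cases ?_ (fun l => ?_) i
    · simp only [Fin.cons_zero]
      fun_prop
    · simp only [Fin.cons_succ]
      fun_prop
  · simp

theorem lintegral_lintegral_cons (F : (Fin (m + 1) → ℝ) → ℝ≥0∞)
    (hF : Measurable fun p : (Fin m → ℝ) × ℝ => F (Fin.cons p.2 p.1)) :
    ∫⁻ x : Fin m → ℝ, ∫⁻ r : ℝ, F (Fin.cons r x) = ∫⁻ z, F z := by
  rw [lintegral_lintegral_swap (f := fun (x : Fin m → ℝ) (r : ℝ) => F (Fin.cons r x))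
    hF.aemeasurable]
  have hmp := (volume_preserving_piFinSuccAbove (fun _ : Fin (m + 1) => ℝ) 0).symm
  rw [← hmp.lintegral_comp_emb (MeasurableEquiv.measurableEmbedding _)]
  have h1 : ∀ p : ℝ × (Fin m → ℝ),
      (MeasurableEquiv.piFinSuccAbove (fun _ : Fin (m + 1) => ℝ) 0).symm p = Fin.cons p.1 p.2 := by
    intro p
    exact Fin.insertNth_zero' p.1 p.2
  simp only [h1]
  rw [Measure.volume_eq_prod, lintegral_prod]
  exact (hF.comp measurable_swap).aemeasurable

theorem lintegral_crossing_univ_le {a : Fin m → Space}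
    (ha : a ∈ Metric.ball (0 : Fin m → Space) 1) (c : SimplexChain G (m + 1)) :
    ∫⁻ x, ‖crossing a x Set.univ c‖ₑ ≤ m.factorial * simplexMass c := by
  obtain ⟨R, hR⟩ := exists_representsPlanes c
  refine (lintegral_mono fun x => ?_).trans (lintegral_sum_fibreTerm_le hR ha)
  refine (enorm_crossing_le hR a x Set.univ).trans (le_of_eq ?_)
  simp

/-- The two faces of the slab contribute the crossings of `c` at the heights `r + δ` and `r`. Their
integrals over `r` agree by translation invariance, so the bound does not depend on δ. -/
theorem lintegral_crossing_slab_simplexBoundary_le {a : Fin m → Space} {x : Fin m → ℝ}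
    {c : SimplexChain G (m + 2)} (hx : ∀ τ ∈ c.support, FibreGeneric a x τ) (h : Space) {δ : ℝ}
    (hδ : 0 ≤ δ) : ∫⁻ r, ‖crossing a x (slab h r δ) (simplexBoundary G (m + 1) c)‖ₑ ≤
      2 * ∫⁻ r, consCrossing c a x h r := by
  have hr : ∀ᵐ r : ℝ, ∀ τ ∈ c.support, ∀ i, r ≠ inner ℝ h (crossPoint a x (face τ i)) := by
    rw [Finset.eventually_all]
    intro τ _
    rw [eventually_all]
    intro i
    exact Measure.ae_ne volume _
  have hV : Measurable (consCrossing c a x h) :=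
    measurable_section (measurable_consCrossing c a) (x, h)
  have hr2 : ∀ᵐ r : ℝ, ∀ τ ∈ c.support, ∀ i, r + δ ≠ inner ℝ h (crossPoint a x (face τ i)) :=
    (measurePreserving_add_right volume δ).quasiMeasurePreserving.ae hr
  calc ∫⁻ r, ‖crossing a x (slab h r δ) (simplexBoundary G (m + 1) c)‖ₑ
      ≤ ∫⁻ r, (consCrossing c a x h (r + δ) + consCrossing c a x h r) := by
        refine lintegral_mono_ae ?_
        filter_upwards [hr, hr2] with r h1 h2
        rw [crossing_slab a x h r hδ, crossing_simplexBoundary hx h1,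
          crossing_simplexBoundary hx h2]
        refine (enorm_sub_le).trans ?_
        rw [enorm_neg, enorm_neg]
        rfl
    _ = 2 * ∫⁻ r, consCrossing c a x h r := by
        rw [lintegral_add_right _ hV, lintegral_add_right_eq_self (consCrossing c a x h) δ,
          two_mul]

/-- By Fubini this is an integral over `ℝᵐ⁺¹` of intersection numbers for the map with rows `h` and
`a`, which are again in the unit ball. -/
theorem lintegral_lintegral_consCrossing_le {a : Fin m → Space}
    (ha : a ∈ Metric.ball (0 : Fin m → Space) 1) {h : Space}
    (hh : h ∈ Metric.ball (0 : Space) 1) (c : SimplexChain G (m + 2)) :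
    ∫⁻ x, ∫⁻ r, consCrossing c a x h r ≤ (m + 1).factorial * simplexMass c := by
  have hg : Measurable fun p : (Fin m → ℝ) × ℝ => ((p.1, h), p.2) := by fun_prop
  have hm := (measurable_consCrossing c a).comp hg
  simp only [Function.comp_def] at hm
  refine (lintegral_lintegral_cons (fun z =>
    ‖crossing (Fin.cons h a : Fin (m + 1) → Space) z Set.univ c‖ₑ) hm).trans_le
    (lintegral_crossing_univ_le ?_ c)
  rw [mem_ball_zero_iff] at ha hh ⊢
  refine (pi_norm_lt_iff one_pos).mpr fun i => ?_
  refine Fin.cases ?_ (fun l => ?_) i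
  · simpa using hh
  · simpa using (norm_le_pi_norm a l).trans_lt ha

theorem lintegral_lintegral_lintegral_crossing_simplexBoundary_le {a : Fin m → Space}
    (ha : a ∈ Metric.ball (0 : Fin m → Space) 1) {δ : ℝ} (hδ : 0 ≤ δ)
    (c : SimplexChain G (m + 2)) :
    ∫⁻ x, ∫⁻ h in Metric.ball (0 : Space) 1,
        ∫⁻ r, ‖crossing a x (slab h r δ) (simplexBoundary G (m + 1) c)‖ₑ ≤
      2 * (volume (Metric.ball (0 : Space) 1) * (m + 1).factorial) * simplexMass c := by
  have hx : ∀ᵐ x, ∀ τ ∈ c.support, FibreGeneric a x τ := by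
    rw [Finset.eventually_all]
    exact fun τ _ => ae_fibreGeneric a τ
  have hm : Measurable fun p : (Fin m → ℝ) × Space => ∫⁻ r, consCrossing c a p.1 p.2 r :=
    (measurable_consCrossing c a).lintegral_prod_right'
  calc ∫⁻ x, ∫⁻ h in Metric.ball (0 : Space) 1,
        ∫⁻ r, ‖crossing a x (slab h r δ) (simplexBoundary G (m + 1) c)‖ₑ
      ≤ ∫⁻ x, ∫⁻ h in Metric.ball (0 : Space) 1, 2 * ∫⁻ r, consCrossing c a x h r := by
        refine lintegral_mono_ae ?_
        filter_upwards [hx] with x hx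
        exact lintegral_mono fun h => lintegral_crossing_slab_simplexBoundary_le hx h hδ
    -- The integrals over `x` and `r` are brought together at fixed `h`.
    _ = ∫⁻ h in Metric.ball (0 : Space) 1, ∫⁻ x, 2 * ∫⁻ r, consCrossing c a x h r :=
        lintegral_lintegral_swap (hm.const_mul 2).aemeasurable
    _ ≤ ∫⁻ _ in Metric.ball (0 : Space) 1, 2 * ((m + 1).factorial * simplexMass c) := by
        refine setLIntegral_mono' Metric.isOpen_ball.measurableSet fun h hh => ?_
        rw [lintegral_const_mul' _ _ (by simp)]
        gcongr
        exact lintegral_lintegral_consCrossing_le ha hh c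
    _ = 2 * (volume (Metric.ball (0 : Space) 1) * (m + 1).factorial) * simplexMass c := by
        rw [setLIntegral_const]
        ring

/-- The averaged variation of a boundary is controlled by the mass of the chain. -/
theorem exists_averagedVariation_simplexBoundary_le (G : Type*) [NormedAddCommGroup G] (m : ℕ) :
    ∃ K : ℝ≥0∞, K ≠ ∞ ∧ ∀ δ : ℝ, 0 ≤ δ → ∀ c : SimplexChain G (m + 2),
      averagedVariation δ (simplexBoundary G (m + 1) c) ≤ K * simplexMass c := by
  refine ⟨volume (Metric.ball (0 : Fin m → Space) 1) * (2 *
    (volume (Metric.ball (0 : Space) 1) * (m + 1).factorial)), ?_, fun δ hδ c => ?_⟩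
  · exact ENNReal.mul_ne_top measure_ball_lt_top.ne (ENNReal.mul_ne_top (by simp)
      (ENNReal.mul_ne_top measure_ball_lt_top.ne (by simp)))
  refine (setLIntegral_mono' Metric.isOpen_ball.measurableSet fun a ha =>
    lintegral_lintegral_lintegral_crossing_simplexBoundary_le ha hδ c).trans_eq ?_
  rw [setLIntegral_const]
  ring

end

/-! ### Lower semicontinuity of the mass -/

section

variable {G : Type*} [NormedAddCommGroup G]

/-- The mass of a polyhedral chain is almost attained by the chains that are close to it in the flat
norm. -/
theorem exists_le_polyMass_add {m : ℕ} (P : PolyChain G (m + 1)) {η : ℝ≥0∞}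
    (hη : η < polyMass P) : ∃ K : ℝ≥0∞, K ≠ ∞ ∧
      ∀ (B : PolyChain G (m + 1)) (C : PolyChain G (m + 2)),
        η ≤ polyMass (P + B + polyBoundary G (m + 1) C) + polyMass B + K * polyMass C := by
  obtain ⟨κ, hκ0, hκt, hκ⟩ := exists_meanAreaFactor m
  obtain ⟨K, hK, hbd⟩ := exists_averagedVariation_simplexBoundary_le G m
  induction P using QuotientAddGroup.induction_on with
  | H p =>
  rw [polyMass_mk] at hη
  set t : ℝ≥0∞ := volume (Metric.ball (0 : Space) 1) * κ with ht
  have ht0 : t ≠ 0 := mul_ne_zero (Metric.measure_ball_pos volume _ one_pos).ne' hκ0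
  have htt : t ≠ ∞ := ENNReal.mul_ne_top measure_ball_lt_top.ne hκt
  have h1 : t * η < liminf (fun i => (ENNReal.ofReal (scale i))⁻¹ *
      averagedVariation (scale i) p) atTop :=
    (ENNReal.mul_lt_mul_right ht0 htt hη).trans_le (le_liminf_averagedVariation hκ p)
  -- The scale is fixed here, before `B` and `C`, so that `K` depends on `P` and `η` only.
  obtain ⟨i, hi⟩ := (eventually_lt_of_lt_liminf h1).exists
  set s : ℝ≥0∞ := ENNReal.ofReal (scale i) with hs
  have hs0 : s ≠ 0 := (ENNReal.ofReal_pos.mpr (scale_pos i)).ne'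
  have hst : s ≠ ∞ := ENNReal.ofReal_ne_top
  refine ⟨t⁻¹ * (s⁻¹ * K), ENNReal.mul_ne_top (ENNReal.inv_ne_top.mpr ht0)
    (ENNReal.mul_ne_top (ENNReal.inv_ne_top.mpr hs0) hK), fun B C => ?_⟩
  induction B using QuotientAddGroup.induction_on with
  | H b =>
  induction C using QuotientAddGroup.induction_on with
  | H c =>
  change η ≤ simplexMass (p + b + simplexBoundary G (m + 1) c) + simplexMass b +
    t⁻¹ * (s⁻¹ * K) * simplexMass c
  have h2 : averagedVariation (scale i) p ≤
      s * t * simplexMass (p + b + simplexBoundary G (m + 1) c) + s * t * simplexMass b +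
        K * simplexMass c := by
    have e : p = (p + b + simplexBoundary G (m + 1) c) + -b + -simplexBoundary G (m + 1) c := by
      abel
    conv_lhs => rw [e]
    refine (averagedVariation_add_le _ _ _).trans (add_le_add
      ((averagedVariation_add_le _ _ _).trans (add_le_add (averagedVariation_le hκ _ _) ?_)) ?_)
    · rw [averagedVariation_neg]
      exact averagedVariation_le hκ _ _
    · rw [averagedVariation_neg]
      exact hbd _ (scale_pos i).le c
  have h3 : t * η ≤ t * (simplexMass (p + b + simplexBoundary G (m + 1) c) + simplexMass b +
      t⁻¹ * (s⁻¹ * K) * simplexMass c) := by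
    refine hi.le.trans ((mul_le_mul_right h2 s⁻¹).trans (le_of_eq ?_))
    have e1 : s⁻¹ * s = 1 := ENNReal.inv_mul_cancel hs0 hst
    have e2 : t * t⁻¹ = 1 := ENNReal.mul_inv_cancel ht0 htt
    calc _ = (s⁻¹ * s) * t * (simplexMass (p + b + simplexBoundary G (m + 1) c) +
          simplexMass b) + s⁻¹ * K * simplexMass c := by ring
      _ = t * (simplexMass (p + b + simplexBoundary G (m + 1) c) + simplexMass b) +
          (t * t⁻¹) * (s⁻¹ * K) * simplexMass c := by rw [e1, e2, one_mul, one_mul]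
      _ = _ := by ring
  exact (ENNReal.mul_le_mul_iff_right ht0 htt).mp h3

/-! ### Lower semicontinuity of weight, mass and energy -/

variable {k : ℕ}

theorem boundary_fst (C : Dipolyhedron G (k + 1)) :
    (boundary G k C).1 = polyBoundary G (k + 1) C.1 + C.2 := by
  change polyBoundary G (k + 1) C.1 + (C.2 - 0) = _
  rw [sub_zero]

theorem boundary_snd (C : Dipolyhedron G (k + 1)) :
    (boundary G k C).2 = -polyBoundary G k C.2 := by
  change 0 + (0 - polyBoundary G k C.2) = _
  rw [zero_sub, zero_add]

/-- The functional `F` is bounded below near each dipolyhedron, up to a multiple of the flat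
distance, by any number less than its value there. -/
def FlatLowerBound (F : Dipolyhedron G k → ℝ≥0∞) : Prop :=
  ∀ (D : Dipolyhedron G k) (η : ℝ≥0∞), η < F D → ∃ K : ℝ≥0∞, K ≠ ∞ ∧
    ∀ D' : Dipolyhedron G k, η ≤ F D' + K * flatEnergy (D' - D)

/-- A bound for every decomposition passes to the infimum after division by `K`. This needs `K ≠ 0`;
for `K = 0` the decomposition with `C = 0` suffices. -/
theorem le_add_mul_flatEnergy {D : Dipolyhedron G k} {η y K : ℝ≥0∞} (hK : K ≠ ∞)
    (h : ∀ (B : Dipolyhedron G k) (C : Dipolyhedron G (k + 1)), D = B + boundary G k C →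
      η ≤ y + K * (energy B + energy C)) : η ≤ y + K * flatEnergy D := by
  by_cases hK0 : K = 0
  · have := h D 0 (by rw [map_zero, add_zero])
    simpa [hK0] using this
  rw [← tsub_le_iff_left, ← ENNReal.div_le_iff' hK0 hK]
  refine le_iInf fun B => le_iInf fun C => le_iInf fun hD => ?_
  rw [ENNReal.div_le_iff' hK0 hK, tsub_le_iff_left]
  exact h B C hD

/-- In the first component, the mass part of `C` enters undifferentiated and joins `B.1` as the
small chain; only `C.1` enters through its boundary. -/
theorem flatLowerBound_weight : FlatLowerBound (weight : Dipolyhedron G k → ℝ≥0∞) := by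
  intro D η hη
  obtain ⟨K, hK, h⟩ := exists_le_polyMass_add D.1 hη
  refine ⟨1 + K, ENNReal.add_ne_top.mpr ⟨ENNReal.one_ne_top, hK⟩, fun D' =>
    le_add_mul_flatEnergy (ENNReal.add_ne_top.mpr ⟨ENNReal.one_ne_top, hK⟩) fun B C hD => ?_⟩
  have h1 := h (B.1 + C.2) C.1
  have h2 : D'.1 = D.1 + (B.1 + C.2) + polyBoundary G (k + 1) C.1 := by
    have := congrArg Prod.fst hD
    change D'.1 - D.1 = B.1 + (boundary G k C).1 at this
    rw [boundary_fst] at this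
    rw [sub_eq_iff_eq_add.mp this]
    abel
  rw [← h2] at h1
  refine h1.trans ?_
  change _ ≤ polyMass D'.1 + (1 + K) * ((polyMass B.1 + polyMass B.2) +
    (polyMass C.1 + polyMass C.2))
  calc polyMass D'.1 + polyMass (B.1 + C.2) + K * polyMass C.1
      ≤ polyMass D'.1 + (polyMass B.1 + polyMass C.2) + K * polyMass C.1 := by
        gcongr
        exact polyMass_add_le _ _
    _ ≤ polyMass D'.1 + (polyMass B.1 + polyMass C.2) + K * polyMass C.1 +
        (polyMass B.2 + polyMass C.1 + K * (polyMass B.1 + polyMass B.2 + polyMass C.2)) :=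
        le_self_add
    _ = _ := by ring

theorem flatLowerBound_mass : FlatLowerBound (mass : Dipolyhedron G k → ℝ≥0∞) := by
  intro D η hη
  -- For `k = 0` the mass chains come from the trivial group of chains of dimension `-1`.
  rcases k with _ | k
  · have h0 : mass D = 0 := by
      change polyMass D.2 = 0
      rw [Subsingleton.elim D.2 0, polyMass_zero]
    rw [h0] at hη
    exact absurd hη not_lt_zero
  obtain ⟨K, hK, h⟩ := exists_le_polyMass_add D.2 hη
  refine ⟨1 + K, ENNReal.add_ne_top.mpr ⟨ENNReal.one_ne_top, hK⟩, fun D' =>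
    le_add_mul_flatEnergy (ENNReal.add_ne_top.mpr ⟨ENNReal.one_ne_top, hK⟩) fun B C hD => ?_⟩
  have h1 := h B.2 (-C.2)
  have h2 : D'.2 = D.2 + B.2 + polyBoundary G (k + 1) (-C.2) := by
    have := congrArg Prod.snd hD
    change D'.2 - D.2 = B.2 + (boundary G (k + 1) C).2 at this
    rw [boundary_snd, ← map_neg] at this
    rw [sub_eq_iff_eq_add.mp this]
    abel
  rw [← h2, polyMass_neg] at h1
  refine h1.trans ?_
  change _ ≤ polyMass D'.2 + (1 + K) * ((polyMass B.1 + polyMass B.2) +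
    (polyMass C.1 + polyMass C.2))
  calc polyMass D'.2 + polyMass B.2 + K * polyMass C.2
      ≤ polyMass D'.2 + polyMass B.2 + K * polyMass C.2 + (polyMass B.1 + polyMass C.1 +
        polyMass C.2 + K * (polyMass B.1 + polyMass B.2 + polyMass C.1)) := le_self_add
    _ = _ := by ring

/-- For fixed `η` the constant `K` is fixed, so the error term tends to zero; then let `η` increase
to `F D`. -/
theorem FlatLowerBound.le_liminf {F : Dipolyhedron G k → ℝ≥0∞} (hF : FlatLowerBound F)
    {D : Dipolyhedron G k} {Ds : ℕ → Dipolyhedron G k}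
    (h : Tendsto (fun i => flatEnergy (Ds i - D)) atTop (𝓝 0)) :
    F D ≤ liminf (fun i => F (Ds i)) atTop := by
  refine le_of_forall_lt fun η' hη' => ?_
  obtain ⟨η, h1, h2⟩ := exists_between hη'
  obtain ⟨K, hK, h3⟩ := hF D η h2
  have h4 : Tendsto (fun i => K * flatEnergy (Ds i - D)) atTop (𝓝 0) := by
    simpa using ENNReal.Tendsto.const_mul h (Or.inr hK)
  refine h1.trans_le ?_
  rw [← ENNReal.liminf_add_of_right_tendsto_zero h4]
  exact le_liminf_of_le (by isBoundedDefault) (Eventually.of_forall fun i => h3 (Ds i))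

theorem weight_le_liminf {D : Dipolyhedron G k} {Ds : ℕ → Dipolyhedron G k}
    (h : Tendsto (fun i => flatEnergy (Ds i - D)) atTop (𝓝 0)) :
    weight D ≤ liminf (fun i => weight (Ds i)) atTop :=
  flatLowerBound_weight.le_liminf h

theorem mass_le_liminf {D : Dipolyhedron G k} {Ds : ℕ → Dipolyhedron G k}
    (h : Tendsto (fun i => flatEnergy (Ds i - D)) atTop (𝓝 0)) :
    mass D ≤ liminf (fun i => mass (Ds i)) atTop :=
  flatLowerBound_mass.le_liminf h

theorem liminf_add_liminf_le (u v : ℕ → ℝ≥0∞) :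
    liminf u atTop + liminf v atTop ≤ liminf (fun i => u i + v i) atTop := by
  simp only [liminf_eq_iSup_iInf_of_nat]
  rw [ENNReal.iSup_add_iSup_of_monotone]
  · refine iSup_mono fun n => le_iInf₂ fun i hi => ?_
    exact add_le_add (iInf₂_le i hi) (iInf₂_le i hi)
  · exact fun a b hab => le_iInf₂ fun i hi => iInf₂_le i (hab.trans hi)
  · exact fun a b hab => le_iInf₂ fun i hi => iInf₂_le i (hab.trans hi)

theorem energy_le_liminf {D : Dipolyhedron G k} {Ds : ℕ → Dipolyhedron G k}
    (h : Tendsto (fun i => flatEnergy (Ds i - D)) atTop (𝓝 0)) :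
    energy D ≤ liminf (fun i => energy (Ds i)) atTop :=
  (add_le_add (weight_le_liminf h) (mass_le_liminf h)).trans
    (liminf_add_liminf_le _ _)

/-! ### Flat dipolyhedra -/

theorem tendsto_coe_iff {D : Dipolyhedron G k} {Ds : ℕ → Dipolyhedron G k} :
    Tendsto (fun i => (Ds i : FlatDipolyhedron G k)) atTop (𝓝 (D : FlatDipolyhedron G k)) ↔
      Tendsto (fun i => flatEnergy (Ds i - D)) atTop (𝓝 0) := by
  rw [tendsto_iff_norm_sub_tendsto_zero]
  simp only [← UniformSpace.Completion.coe_sub, UniformSpace.Completion.norm_coe,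
    norm_eq_flatEnergy]
  exact ENNReal.tendsto_toReal_zero_iff fun i => (flatEnergy_lt_top _).ne

/-- A functional that is lower semicontinuous along sequences of dipolyhedra agrees with its
relaxation. -/
theorem relaxation_coe {F : Dipolyhedron G k → ℝ≥0∞}
    (hF : ∀ (D : Dipolyhedron G k) (Ds : ℕ → Dipolyhedron G k),
      Tendsto (fun i => flatEnergy (Ds i - D)) atTop (𝓝 0) →
        F D ≤ liminf (fun i => F (Ds i)) atTop) (D : Dipolyhedron G k) :
    relaxation F (D : FlatDipolyhedron G k) = F D := by
  refine le_antisymm ?_ (le_iInf₂ fun Ds h => hF D Ds (tendsto_coe_iff.mp h))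
  refine (iInf₂_le (fun _ => D) tendsto_const_nhds).trans ?_
  rw [liminf_const]

/-- Along a nearly optimal sequence `F` is below `y` infinitely often, while the terms are
eventually close to `A`. -/
theorem exists_dist_lt_of_relaxation_lt {F : Dipolyhedron G k → ℝ≥0∞}
    {A : FlatDipolyhedron G k} {y : ℝ≥0∞} (h : relaxation F A < y) {ε : ℝ} (hε : 0 < ε) :
    ∃ D : Dipolyhedron G k, dist (D : FlatDipolyhedron G k) A < ε ∧ F D < y := by
  simp only [relaxation, iInf_lt_iff] at h
  obtain ⟨Ds, hD, hl⟩ := h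
  have h1 := frequently_lt_of_liminf_lt (by isBoundedDefault) hl
  obtain ⟨i, hi, hi'⟩ := (h1.and_eventually (hD.eventually (Metric.ball_mem_nhds A hε))).exists
  exact ⟨Ds i, hi', hi⟩

/-- If the relaxation stayed small at points arbitrarily near `A`, dipolyhedra chosen near those
points would form a sequence that tends to `A` with small values of `F`. -/
theorem lowerSemicontinuous_relaxation (F : Dipolyhedron G k → ℝ≥0∞) :
    LowerSemicontinuous (relaxation F : FlatDipolyhedron G k → ℝ≥0∞) := by
  intro A y hy
  -- The values `F (Ds i)` will be below `y'`, so their lower limit is at most `y'`, still strictly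
  -- less than the relaxation at `A`.
  obtain ⟨y', hy', hA⟩ := exists_between hy
  by_contra hcon
  rw [Metric.nhds_basis_ball.eventually_iff] at hcon
  push Not at hcon
  have h1 : ∀ i : ℕ, ∃ D : Dipolyhedron G k,
      dist (D : FlatDipolyhedron G k) A < scale i + scale i ∧ F D < y' := by
    intro i
    obtain ⟨B, hB, hBy⟩ := hcon (scale i) (scale_pos i)
    obtain ⟨D, hD, hDy⟩ := exists_dist_lt_of_relaxation_lt (hBy.trans_lt hy') (scale_pos i)
    exact ⟨D, (dist_triangle _ B A).trans_lt (add_lt_add hD hB), hDy⟩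
  choose Ds hDs hF using h1
  have h2 : Tendsto scale atTop (𝓝 0) := tendsto_one_div_add_atTop_nhds_zero_nat
  have h3 : Tendsto (fun i => (Ds i : FlatDipolyhedron G k)) atTop (𝓝 A) := by
    rw [tendsto_iff_dist_tendsto_zero]
    refine squeeze_zero (fun i => dist_nonneg) (fun i => (hDs i).le) ?_
    simpa using h2.add h2
  have h4 : liminf (fun i => F (Ds i)) atTop ≤ y' :=
    (liminf_le_liminf (Eventually.of_forall fun i => (hF i).le)).trans_eq (liminf_const y')
  have h5 : relaxation F A ≤ liminf (fun i => F (Ds i)) atTop := iInf₂_le Ds h3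
  exact absurd (h5.trans h4) (not_le.mpr hA)

end

end SoapFilm

end

theorem mainTheorem3 {G : Type*} [NormedAddCommGroup G] [CompleteSpace G] (k : ℕ) :
    (∀ (D : SoapFilm.Dipolyhedron G k) (Ds : ℕ → SoapFilm.Dipolyhedron G k),
      Tendsto (fun i => SoapFilm.flatEnergy (Ds i - D)) atTop (𝓝 0) →
        SoapFilm.weight D ≤ liminf (fun i => SoapFilm.weight (Ds i)) atTop ∧
        SoapFilm.mass D ≤ liminf (fun i => SoapFilm.mass (Ds i)) atTop ∧
        SoapFilm.energy D ≤ liminf (fun i => SoapFilm.energy (Ds i)) atTop) ∧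
    (∀ D : SoapFilm.Dipolyhedron G k,
      SoapFilm.flatWeight (D : SoapFilm.FlatDipolyhedron G k) = SoapFilm.weight D ∧
      SoapFilm.flatMass (D : SoapFilm.FlatDipolyhedron G k) = SoapFilm.mass D ∧
      SoapFilm.flatDipolyhedronEnergy (D : SoapFilm.FlatDipolyhedron G k) =
        SoapFilm.energy D) ∧
    LowerSemicontinuous (SoapFilm.flatWeight : SoapFilm.FlatDipolyhedron G k → ℝ≥0∞) ∧
    LowerSemicontinuous (SoapFilm.flatMass : SoapFilm.FlatDipolyhedron G k → ℝ≥0∞) ∧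
    LowerSemicontinuous
      (SoapFilm.flatDipolyhedronEnergy : SoapFilm.FlatDipolyhedron G k → ℝ≥0∞) := by
  refine ⟨fun D Ds h => ⟨SoapFilm.weight_le_liminf h, SoapFilm.mass_le_liminf h,
    SoapFilm.energy_le_liminf h⟩, fun D => ⟨?_, ?_, ?_⟩,
    SoapFilm.lowerSemicontinuous_relaxation SoapFilm.weight,
    SoapFilm.lowerSemicontinuous_relaxation SoapFilm.mass,
    SoapFilm.lowerSemicontinuous_relaxation SoapFilm.energy⟩
  · exact SoapFilm.relaxation_coe (F := SoapFilm.weight)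
      (fun _ _ h => SoapFilm.weight_le_liminf h) D
  · exact SoapFilm.relaxation_coe (F := SoapFilm.mass) (fun _ _ h => SoapFilm.mass_le_liminf h) D
  · exact SoapFilm.relaxation_coe (F := SoapFilm.energy)
      (fun _ _ h => SoapFilm.energy_le_liminf h) D
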